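/- **Theorem (PBW basis).** Let $\Bbbk$ be a field, let $n\ge 0$, and let $x_1,\dots,x_n$ be generators with degrees $|x_i|\in\mathbb Z$. Let $$R=\Bbbk\langle x_1,\dots,x_n\rangle\big/\big(x_ix_j-(-1)^{|x_i||x_j|}x_jx_i \;:\; 1\le i,j\le n\big)$$ be the graded commutative polynomial algebra on them. Let $R$ carry an arbitrary differential graded Poisson structure: a $\Bbbk$-bilinear bracket $\{\cdot,\cdot\}$ of degree $0$ and a $\Bbbk$-linear map $d$ of degree $1$ with $d^2=0$ such that, for all homogeneous $a,b,c\in R$, - $\{a,b\}=-(-1)^{|a||b|}\{b,a\}$, - $\{a,\{b,c\}\}=\{\{a,b\},c\}+(-1)^{|a||b|}\{b,\{a,c\}\}$, - $\{a,bc\}=\{a,b\}c+(-1)^{|a||b|}b\{a,c\}$, - $d\{a,b\}=\{d(a),b\}+(-1)^{|a|}\{a,d(b)\}$, - $d(ab)=d(a)b+(-1)^{|a|}a\,d(b)$. If $\operatorname{char}\Bbbk=2$, assume in addition that $\{x_i,x_i\}=0$ for all $i$; if $\operatorname{char}\Bbbk=3$, assume in addition that $\{x_i,\{x_i,x_i\}\}=0$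 for all $i$ with $|x_i|$ odd. (In all other characteristics nothing is added.) For $1\le r\le n$ let $\psi_r:R\to R$ be the $\Bbbk$-linear map determined by $\psi_r(x_i)=\delta_{ri}$ and $\psi_r(ab)=a\psi_r(b)+(-1)^{|a||b|}b\psi_r(a)$ for homogeneous $a,b$. Let $F(R)=R\langle y_1,\dots,y_n\rangle$ be the free product over $\Bbbk$ of $R$ and the free algebra $\Bbbk\langle y_1,\dots,y_n\rangle$, and put $\psi(f)=\sum_{r=1}^n\psi_r(f)\,y_r\in F(R)$ for $f\in R$. The universal enveloping algebra of $R$ is $R^e=F(R)/J$, where $J$ is the two-sided ideal generated by $$y_iy_j-(-1)^{|x_i||x_j|}y_jy_i-\psi(\{x_i,x_j\}),\qquad y_ix_j-(-1)^{|x_i||x_j|}x_jy_i-\{x_i,x_j\}\qquad(1\le i,j\le n).$$ Then the ordered monomials $$x_1^{i_1}x_2^{i_2}\cdots x_n^{i_n}\,y_1^{j_1}y_2^{j_2}\cdots y_n^{j_n},\qquad i_r,j_r\in\{0,1,2,\dots\},$$ with $i_r,j_r\le 1$ for every $r$ such that $|x_r|$ is odd when $\operatorname{char}\Bbbk\ne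 2$, are pairwise distinct and form a $\Bbbk$-linear basis of $R^e$. -/

import Mathlib

/-! # Differential graded Poisson algebras and the enveloping algebra of a
graded commutative polynomial algebra -/

namespace DGP

/-- A DG Poisson structure on a `ℤ`-graded `k`-algebra `A = ⨁ m, 𝒜 m`: a Poisson bracket of degree `0`
and a differential of degree `1`. The Koszul sign `(-1) ^ (p * q)` is an integer power in `k`. -/
structure DGPoisson {k A : Type*} [Field k] [Ring A] [Algebra k A]
    (𝒜 : ℤ → Submodule k A) [GradedAlgebra 𝒜] where
  /-- the Poisson bracket `{a, b}` -/
  bracket : A →ₗ[k] A →ₗ[k] A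
  /-- the differential -/
  d : A →ₗ[k] A
  bracket_mem : ∀ {p q : ℤ} {a b : A}, a ∈ 𝒜 p → b ∈ 𝒜 q → bracket a b ∈ 𝒜 (p + q)
  antisymm : ∀ {p q : ℤ} {a b : A}, a ∈ 𝒜 p → b ∈ 𝒜 q →
    bracket a b = -((-1 : k) ^ (p * q) • bracket b a)
  jacobi : ∀ {p q r : ℤ} {a b c : A}, a ∈ 𝒜 p → b ∈ 𝒜 q → c ∈ 𝒜 r →
    bracket a (bracket b c) =
      bracket (bracket a b) c + (-1 : k) ^ (p * q) • bracket b (bracket a c)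
  graded_comm : ∀ {p q : ℤ} {a b : A}, a ∈ 𝒜 p → b ∈ 𝒜 q →
    a * b = (-1 : k) ^ (p * q) • (b * a)
  bracket_mul : ∀ {p q r : ℤ} {a b c : A}, a ∈ 𝒜 p → b ∈ 𝒜 q → c ∈ 𝒜 r →
    bracket a (b * c) = bracket a b * c + (-1 : k) ^ (p * q) • (b * bracket a c)
  d_mem : ∀ {p : ℤ} {a : A}, a ∈ 𝒜 p → d a ∈ 𝒜 (p + 1)
  d_d : ∀ a : A, d (d a) = 0
  d_bracket : ∀ {p q : ℤ} {a b : A}, a ∈ 𝒜 p → b ∈ 𝒜 q →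
    d (bracket a b) = bracket (d a) b + (-1 : k) ^ p • bracket a (d b)
  d_mul : ∀ {p q : ℤ} {a b : A}, a ∈ 𝒜 p → b ∈ 𝒜 q →
    d (a * b) = d a * b + (-1 : k) ^ p • (a * d b)

section Poly

variable (k : Type*) [Field k] {n : ℕ} (deg : Fin n → ℤ)

/-- The relations `x_i x_j = (-1)^{|x_i||x_j|} x_j x_i` for all `i, j` (including `i = j`). -/
inductive PolyRel : FreeAlgebra k (Fin n) → FreeAlgebra k (Fin n) → Prop
  | comm (i j : Fin n) : PolyRel (FreeAlgebra.ι k i * FreeAlgebra.ι k j)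
      ((-1 : k) ^ (deg i * deg j) • (FreeAlgebra.ι k j * FreeAlgebra.ι k i))

/-- The graded commutative polynomial algebra `R = T(V)/(x_i x_j - (-1)^{|x_i||x_j|} x_j x_i)`, where `V`
has the homogeneous basis `x_0, …, x_{n-1}` with `|x_i| = deg i`. -/
def Poly : Type _ := RingQuot (PolyRel k deg)

instance : Ring (Poly k deg) := inferInstanceAs (Ring (RingQuot (PolyRel k deg)))

instance : Algebra k (Poly k deg) := inferInstanceAs (Algebra k (RingQuot (PolyRel k deg)))

/-- The generator `x_i` of `R`. -/
def Poly.x (i : Fin n) : Poly k deg := RingQuot.mkAlgHom k (PolyRel k deg) (FreeAlgebra.ι k i)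

theorem Poly.x_comm (i j : Fin n) :
    Poly.x k deg i * Poly.x k deg j =
      (-1 : k) ^ (deg i * deg j) • (Poly.x k deg j * Poly.x k deg i) := by
  have h := RingQuot.mkAlgHom_rel k (PolyRel.comm (k := k) (deg := deg) i j)
  rw [map_mul, map_smul, map_mul] at h
  exact h

/-- The universal property of `R`. -/
def Poly.lift {B : Type*} [Ring B] [Algebra k B] (f : Fin n → B)
    (hf : ∀ i j, f i * f j = (-1 : k) ^ (deg i * deg j) • (f j * f i)) : Poly k deg →ₐ[k] B :=
  RingQuot.liftAlgHom k ⟨FreeAlgebra.lift k f, by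
    rintro _ _ ⟨i, j⟩
    simpa using hf i j⟩

@[simp] theorem Poly.lift_x {B : Type*} [Ring B] [Algebra k B] (f : Fin n → B)
    (hf : ∀ i j, f i * f j = (-1 : k) ^ (deg i * deg j) • (f j * f i)) (i : Fin n) :
    Poly.lift k deg f hf (Poly.x k deg i) = f i := by
  refine (RingQuot.liftAlgHom_mkAlgHom_apply k (FreeAlgebra.lift k f) _ _).trans ?_
  simp

theorem Poly.hom_ext {B : Type*} [Ring B] [Algebra k B] {f g : Poly k deg →ₐ[k] B}
    (h : ∀ i, f (Poly.x k deg i) = g (Poly.x k deg i)) : f = g := by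
  apply RingQuot.ringQuot_ext'
  apply FreeAlgebra.hom_ext
  funext i
  exact h i

/-- The homogeneous component of degree `m` of `R`, spanned by the words in the `x_i` of total
degree `m`. -/
def Poly.comp (m : ℤ) : Submodule k (Poly k deg) :=
  Submodule.span k {a | ∃ l : List (Fin n), (l.map deg).sum = m ∧ a = (l.map (Poly.x k deg)).prod}

theorem Poly.word_mem (l : List (Fin n)) :
    (l.map (Poly.x k deg)).prod ∈ Poly.comp k deg (l.map deg).sum :=
  Submodule.subset_span ⟨l, rfl, rfl⟩

theorem Poly.x_mem (i : Fin n) : Poly.x k deg i ∈ Poly.comp k deg (deg i) := by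
  simpa using Poly.word_mem k deg [i]

instance Poly.gradedMonoid : SetLike.GradedMonoid (Poly.comp k deg) where
  one_mem := by simpa using Poly.word_mem k deg []
  mul_mem := by
    intro p q a b ha hb
    have h : a * b ∈ Poly.comp k deg p * Poly.comp k deg q := Submodule.mul_mem_mul ha hb
    refine (?_ : Poly.comp k deg p * Poly.comp k deg q ≤ Poly.comp k deg (p + q)) h
    unfold Poly.comp
    rw [Submodule.span_mul_span]
    apply Submodule.span_mono
    rintro _ ⟨_, ⟨l, hl, rfl⟩, _, ⟨l', hl', rfl⟩, rfl⟩
    exact ⟨l ++ l', by simp [hl, hl'], by simp⟩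

/-- The decomposition map of the grading of `R`. -/
noncomputable def Poly.decomp : Poly k deg →ₐ[k] DirectSum ℤ (fun m => Poly.comp k deg m) :=
  Poly.lift k deg
    (fun i => DirectSum.of (fun m => Poly.comp k deg m) (deg i) ⟨Poly.x k deg i, Poly.x_mem k deg i⟩)
    (by
      intro i j
      rw [DirectSum.of_mul_of, DirectSum.of_mul_of]
      have hs : ∀ (c : k) (m : ℤ) (z : Poly.comp k deg m),
          c • DirectSum.of (fun m => Poly.comp k deg m) m z =
            DirectSum.of (fun m => Poly.comp k deg m) m (c • z) := by
        intro c m z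
        exact ((DirectSum.lof k ℤ (fun m => Poly.comp k deg m) m).map_smul c z).symm
      rw [hs]
      apply DirectSum.of_eq_of_gradedMonoid_eq
      refine Sigma.subtype_ext (add_comm _ _) ?_
      exact Poly.x_comm k deg i j)

theorem Poly.decomp_word (l : List (Fin n)) :
    Poly.decomp k deg (l.map (Poly.x k deg)).prod =
      DirectSum.of (fun m => Poly.comp k deg m) (l.map deg).sum
        ⟨(l.map (Poly.x k deg)).prod, Poly.word_mem k deg l⟩ := by
  induction l with
  | nil =>
    simp only [List.map_nil, List.prod_nil, map_one]
    rfl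
  | cons i l ih =>
    simp only [List.map_cons, List.prod_cons, map_mul, ih]
    rw [Poly.decomp, Poly.lift_x, DirectSum.of_mul_of]
    rfl

noncomputable instance Poly.gradedAlgebra : GradedAlgebra (Poly.comp k deg) :=
  GradedAlgebra.ofAlgHom _ (Poly.decomp k deg)
    (by
      apply Poly.hom_ext
      intro i
      simp [Poly.decomp])
    (by
      rintro m ⟨a, ha⟩
      induction ha using Submodule.span_induction with
      | mem a h =>
        obtain ⟨l, rfl, rfl⟩ := h
        exact Poly.decomp_word k deg l
      | zero =>
        rw [map_zero]
        exact (map_zero (DirectSum.of (fun m => Poly.comp k deg m) m)).symm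
      | add a b ha hb iha ihb =>
        rw [map_add, iha, ihb, ← map_add]
        rfl
      | smul c a ha iha =>
        rw [map_smul, iha]
        exact ((DirectSum.lof k ℤ (fun m => Poly.comp k deg m) m).map_smul c ⟨a, ha⟩).symm)

/-- The algebra map `a ↦ (a, ψ_r(a); 0, σ_r(a))` into `2 × 2` matrices, where `σ_r` is the automorphism
`x_i ↦ (-1)^{|x_i||x_r|} x_i`; its upper right entry is the anti-differential `ψ_r`. -/
def Poly.psiMatrix (r : Fin n) : Poly k deg →ₐ[k] Matrix (Fin 2) (Fin 2) (Poly k deg) :=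
  Poly.lift k deg
    (fun i => !![Poly.x k deg i, if r = i then 1 else 0;
      0, (-1 : k) ^ (deg i * deg r) • Poly.x k deg i])
    (by
      intro i j
      have hsq : ∀ m : ℤ, (-1 : k) ^ m * (-1 : k) ^ m = 1 := fun m => by
        rw [← mul_zpow]; simp
      have h := Poly.x_comm k deg i j
      ext a b
      fin_cases a <;> fin_cases b
      · simp only [Matrix.mul_apply, Fin.sum_univ_two, Matrix.smul_apply]
        simp [h]
      · by_cases hi : r = i
        · by_cases hj : r = j
          · subst hi; subst hj
            simp [Matrix.mul_apply, smul_smul, hsq, add_comm]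
          · subst hi
            simp [Matrix.mul_apply, hj, mul_comm (deg j)]
        · by_cases hj : r = j
          · subst hj
            simp [Matrix.mul_apply, hi, smul_smul, hsq]
          · simp [Matrix.mul_apply, hi, hj]
      · simp [Matrix.mul_apply]
      · simp only [Matrix.mul_apply, Fin.sum_univ_two]
        simp [h, smul_smul]
        congr 1
        ring)

/-- The anti-differential `ψ_r : R → R`: the `k`-linear map with `ψ_r(x_i) = δ_{ri}` and
`ψ_r(ab) = a ψ_r(b) + (-1)^{|a||b|} b ψ_r(a)` for homogeneous `a, b`
(see `Poly.psi_x` and `Poly.psi_mul`). -/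
def Poly.psi (r : Fin n) : Poly k deg →ₗ[k] Poly k deg where
  toFun a := Poly.psiMatrix k deg r a 0 1
  map_add' a b := by simp
  map_smul' c a := by simp

theorem Poly.psi_x (r i : Fin n) : Poly.psi k deg r (Poly.x k deg i) = if r = i then 1 else 0 := by
  simp [Poly.psi, Poly.psiMatrix]

theorem Poly.graded_comm {p q : ℤ} {a b : Poly k deg} (ha : a ∈ Poly.comp k deg p)
    (hb : b ∈ Poly.comp k deg q) : a * b = (-1 : k) ^ (p * q) • (b * a) := by
  have hx : ∀ (i : Fin n) (l : List (Fin n)),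
      Poly.x k deg i * (l.map (Poly.x k deg)).prod =
        (-1 : k) ^ (deg i * (l.map deg).sum) • ((l.map (Poly.x k deg)).prod * Poly.x k deg i) := by
    intro i l
    induction l with
    | nil => simp
    | cons j l ih =>
      simp only [List.map_cons, List.prod_cons, List.sum_cons]
      rw [← mul_assoc, Poly.x_comm, smul_mul_assoc, mul_assoc, ih, mul_smul_comm, smul_smul,
        ← zpow_add₀ (by simp), ← mul_assoc, mul_add]
  have hw : ∀ l l' : List (Fin n),
      (l.map (Poly.x k deg)).prod * (l'.map (Poly.x k deg)).prod =
        (-1 : k) ^ ((l.map deg).sum * (l'.map deg).sum) •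
          ((l'.map (Poly.x k deg)).prod * (l.map (Poly.x k deg)).prod) := by
    intro l l'
    induction l with
    | nil => simp
    | cons j l ih =>
      simp only [List.map_cons, List.prod_cons, List.sum_cons]
      rw [mul_assoc, ih, mul_smul_comm, ← mul_assoc, hx, smul_mul_assoc, smul_smul,
        ← zpow_add₀ (by simp), mul_assoc]
      congr 2
      ring
  induction ha, hb using Submodule.span_induction₂ with
  | mem_mem a b ha hb =>
    obtain ⟨l, rfl, rfl⟩ := ha
    obtain ⟨l', rfl, rfl⟩ := hb
    exact hw l l'
  | zero_left => simp
  | zero_right => simp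
  | add_left a a' b _ _ _ h h' => rw [add_mul, h, h', mul_add, smul_add]
  | add_right a b b' _ _ _ h h' => rw [mul_add, h, h', add_mul, smul_add]
  | smul_left c a b _ _ h => rw [smul_mul_assoc, h, mul_smul_comm, smul_comm]
  | smul_right c a b _ _ h => rw [mul_smul_comm, h, smul_mul_assoc, smul_comm]

theorem Poly.psiMatrix_of_mem (r : Fin n) {p : ℤ} {a : Poly k deg} (ha : a ∈ Poly.comp k deg p) :
    Poly.psiMatrix k deg r a 0 0 = a ∧ Poly.psiMatrix k deg r a 1 0 = 0 ∧
      Poly.psiMatrix k deg r a 1 1 = (-1 : k) ^ (p * deg r) • a ∧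
      Poly.psiMatrix k deg r a 0 1 ∈ Poly.comp k deg (p - deg r) := by
  induction ha using Submodule.span_induction with
  | mem a h =>
    obtain ⟨l, rfl, rfl⟩ := h
    induction l with
    | nil => simp
    | cons j l ih =>
      obtain ⟨h1, h2, h3, h4⟩ := ih
      have hj : Poly.psiMatrix k deg r (Poly.x k deg j) =
          !![Poly.x k deg j, if r = j then 1 else 0;
            0, (-1 : k) ^ (deg j * deg r) • Poly.x k deg j] := by simp [Poly.psiMatrix]
      simp only [List.map_cons, List.prod_cons, List.sum_cons, map_mul, Matrix.mul_apply,
        Fin.sum_univ_two, h1, h2, h3, hj]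
      refine ⟨by simp, by simp, ?_, ?_⟩
      · simp [smul_smul, ← zpow_add₀, add_mul, add_comm]
      · apply Submodule.add_mem
        · have := SetLike.mul_mem_graded (Poly.x_mem k deg j) h4
          simpa [add_sub_assoc] using this
        · by_cases h : r = j
          · subst h
            simpa using Submodule.smul_mem _ _ (Poly.word_mem k deg l)
          · simp [h]
  | zero => simp
  | add a b _ _ iha ihb =>
    obtain ⟨h1, h2, h3, h4⟩ := iha
    obtain ⟨g1, g2, g3, g4⟩ := ihb
    simp only [map_add, Matrix.add_apply]
    exact ⟨by rw [h1, g1], by rw [h2, g2, add_zero], by rw [h3, g3, smul_add],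
      Submodule.add_mem _ h4 g4⟩
  | smul c a _ iha =>
    obtain ⟨h1, h2, h3, h4⟩ := iha
    simp only [map_smul, Matrix.smul_apply]
    exact ⟨by rw [h1], by rw [h2, smul_zero], by rw [h3, smul_comm], Submodule.smul_mem _ _ h4⟩

theorem Poly.psi_mul (r : Fin n) {p q : ℤ} {a b : Poly k deg} (ha : a ∈ Poly.comp k deg p)
    (hb : b ∈ Poly.comp k deg q) : Poly.psi k deg r (a * b) =
      a * Poly.psi k deg r b + (-1 : k) ^ (p * q) • (b * Poly.psi k deg r a) := by
  obtain ⟨h1, -, -, h4⟩ := Poly.psiMatrix_of_mem k deg r ha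
  obtain ⟨-, -, g3, -⟩ := Poly.psiMatrix_of_mem k deg r hb
  change Poly.psiMatrix k deg r (a * b) 0 1 = a * Poly.psiMatrix k deg r b 0 1 +
    (-1 : k) ^ (p * q) • (b * Poly.psiMatrix k deg r a 0 1)
  rw [map_mul, Matrix.mul_apply, Fin.sum_univ_two, h1, g3, mul_smul_comm,
    Poly.graded_comm k deg h4 hb, smul_smul, ← zpow_add₀ (by simp)]
  congr 3
  ring

end Poly

section Env

variable (k : Type*) [Field k] {n : ℕ} (deg : Fin n → ℤ)

/-- The relations of `R` inside the free algebra on `x_i = inl i` and `y_i = inr i`. -/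
inductive FreeRel : FreeAlgebra k (Fin n ⊕ Fin n) → FreeAlgebra k (Fin n ⊕ Fin n) → Prop
  | comm (i j : Fin n) : FreeRel
      (FreeAlgebra.ι k (Sum.inl i) * FreeAlgebra.ι k (Sum.inl j))
      ((-1 : k) ^ (deg i * deg j) • (FreeAlgebra.ι k (Sum.inl j) * FreeAlgebra.ι k (Sum.inl i)))

/-- `F(R) = R⟨y_0, …, y_{n-1}⟩`, the free `R`-ring on the `y_i`, that is, the free product of the
`k`-algebras `R` and `k⟨y_0, …, y_{n-1}⟩`. -/
def FreePoly : Type _ := RingQuot (FreeRel k deg)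

instance : Ring (FreePoly k deg) := inferInstanceAs (Ring (RingQuot (FreeRel k deg)))

instance : Algebra k (FreePoly k deg) := inferInstanceAs (Algebra k (RingQuot (FreeRel k deg)))

/-- The generator `y_i` of `F(R)`. -/
def FreePoly.y (i : Fin n) : FreePoly k deg :=
  RingQuot.mkAlgHom k (FreeRel k deg) (FreeAlgebra.ι k (Sum.inr i))

/-- The canonical map `R → F(R)`. -/
def FreePoly.incl : Poly k deg →ₐ[k] FreePoly k deg :=
  Poly.lift k deg
    (fun i => (RingQuot.mkAlgHom k (FreeRel k deg) (FreeAlgebra.ι k (Sum.inl i)) : FreePoly k deg))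
    (by
      intro i j
      have h := RingQuot.mkAlgHom_rel k (FreeRel.comm (k := k) (deg := deg) i j)
      rw [map_mul, map_smul, map_mul] at h
      exact h)

/-- `ψ : R → F(R)`, `ψ(f) = ∑ r, ψ_r(f) y_r`. -/
def FreePoly.psi (f : Poly k deg) : FreePoly k deg :=
  ∑ r : Fin n, FreePoly.incl k deg (Poly.psi k deg r f) * FreePoly.y k deg r

variable {k deg}

/-- The defining relations of `R^e` on `F(R)`. -/
inductive EnvRel (P : DGPoisson (Poly.comp k deg)) : FreePoly k deg → FreePoly k deg → Prop
  | yy (i j : Fin n) : EnvRel P (FreePoly.y k deg i * FreePoly.y k deg j)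
      ((-1 : k) ^ (deg i * deg j) • (FreePoly.y k deg j * FreePoly.y k deg i) +
        FreePoly.psi k deg (P.bracket (Poly.x k deg i) (Poly.x k deg j)))
  | yx (i j : Fin n) : EnvRel P (FreePoly.y k deg i * FreePoly.incl k deg (Poly.x k deg j))
      ((-1 : k) ^ (deg i * deg j) • (FreePoly.incl k deg (Poly.x k deg j) * FreePoly.y k deg i) +
        FreePoly.incl k deg (P.bracket (Poly.x k deg i) (Poly.x k deg j)))

/-- The universal enveloping algebra `R^e = F(R)/J` of the DG Poisson algebra `R`, where `J` is the
two-sided ideal generated by `y_i y_j - (-1)^{|x_i||x_j|} y_j y_i - ψ({x_i, x_j})` and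
`y_i x_j - (-1)^{|x_i||x_j|} x_j y_i - {x_i, x_j}` for all `i, j`. -/
def Env (P : DGPoisson (Poly.comp k deg)) : Type _ := RingQuot (EnvRel P)

instance (P : DGPoisson (Poly.comp k deg)) : Ring (Env P) :=
  inferInstanceAs (Ring (RingQuot (EnvRel P)))

instance (P : DGPoisson (Poly.comp k deg)) : Algebra k (Env P) :=
  inferInstanceAs (Algebra k (RingQuot (EnvRel P)))

/-- The projection `F(R) → R^e`. -/
def Env.proj (P : DGPoisson (Poly.comp k deg)) : FreePoly k deg →ₐ[k] Env P :=
  RingQuot.mkAlgHom k (EnvRel P)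

/-- The image of `x_i` in `R^e`. -/
def Env.x (P : DGPoisson (Poly.comp k deg)) (i : Fin n) : Env P :=
  Env.proj P (FreePoly.incl k deg (Poly.x k deg i))

/-- The image of `y_i` in `R^e`. -/
def Env.y (P : DGPoisson (Poly.comp k deg)) (i : Fin n) : Env P :=
  Env.proj P (FreePoly.y k deg i)

variable (k deg)

/-- The exponent vectors of the PBW monomials. A generator `x_r` of odd degree satisfies `2 x_r^2 = 0`,
so unless `2 = 0` in `k` the exponents of `x_r` and `y_r` are then at most `1`; otherwise they are
arbitrary. -/
def PBWExponent : Type :=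
  {e : (Fin n → ℕ) × (Fin n → ℕ) //
    ∀ r, Odd (deg r) → (2 : k) ≠ 0 → e.1 r ≤ 1 ∧ e.2 r ≤ 1}

variable {k deg}

/-- The ordered monomial `x_0^{i_0} ⋯ x_{n-1}^{i_{n-1}} y_0^{j_0} ⋯ y_{n-1}^{j_{n-1}}` in `R^e`. -/
def Env.monomial (P : DGPoisson (Poly.comp k deg)) (i j : Fin n → ℕ) : Env P :=
  (List.ofFn fun r => Env.x P r ^ i r).prod * (List.ofFn fun r => Env.y P r ^ j r).prod

end Env

end DGP

/-!
Straightening shows that the ordered monomials in the `y_i` span `R^e` as a left `R`-module. For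
their independence, straightening is turned into operators on the free left `R`-module on the
ordered monomials: the relation between `y_i` and `y_j` holds for these operators by induction on
the length of a monomial, since the overlap `y_i y_j y_l` is resolved by the Jacobi identity. Thus
`R^e` acts, and its action on the empty monomial separates the ordered monomials. The argument
applies verbatim to `R` over `k`, with vanishing brackets, and the `k`-basis of `R^e` consists of
the products of the two bases.
-/

/-- `i` may stand before `j` in a normal word: letters increase, and only a letter satisfying `q`
may be repeated. -/
def Precedes {ι : Type*} [LT ι] (q : ι → Prop) (i j : ι) : Prop :=
  i < j ∨ i = j ∧ q i

/-- A normal word in the letters `ι`, that is, a sorted list in which only the letters satisfying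
`q` are repeated. Normal words encode the ordered monomials. -/
@[ext]
structure NormalWord {ι : Type*} [LT ι] (q : ι → Prop) where
  /-- the letters, in order -/
  toList : List ι
  pairwise : toList.Pairwise (Precedes q)

section NormalWord

variable {ι : Type*} [LinearOrder ι] {q : ι → Prop} {i j l : ι}

theorem Precedes.trans (h : Precedes q i j) (h' : Precedes q j l) : Precedes q i l := by
  rcases h with h | ⟨rfl, _⟩
  · exact Or.inl (h'.elim h.trans fun h' => h'.1 ▸ h)
  · exact h'

theorem Precedes.antisymm (h : Precedes q i j) (h' : Precedes q j i) : i = j :=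
  le_antisymm (h.elim le_of_lt fun h => h.1.le) (h'.elim le_of_lt fun h => h.1.le)

theorem not_precedes_iff : ¬ Precedes q i j ↔ j < i ∨ i = j ∧ ¬ q i := by
  simp only [Precedes, not_or, not_and, not_lt, le_iff_lt_or_eq]
  grind

namespace NormalWord

/-- The empty word. -/
def nil : NormalWord q := ⟨[], List.Pairwise.nil⟩

/-- The number of letters. -/
def length (K : NormalWord q) : ℕ := K.toList.length

/-- `K.Fits i` says that the letter `i` may be prepended to `K`. -/
def Fits (i : ι) (K : NormalWord q) : Prop := ∀ j ∈ K.toList, Precedes q i j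

/-- The word `K` with the letter `i` prepended. -/
def cons (i : ι) (K : NormalWord q) (h : K.Fits i) : NormalWord q :=
  ⟨i :: K.toList, List.pairwise_cons.2 ⟨h, K.pairwise⟩⟩

variable {J K : NormalWord q}

@[simp] theorem length_cons (h : K.Fits i) : (cons i K h).length = K.length + 1 :=
  List.length_cons

theorem fits_nil (i : ι) : (nil : NormalWord q).Fits i :=
  List.forall_mem_nil _

theorem fits_cons_iff (h : K.Fits j) : (cons j K h).Fits i ↔ Precedes q i j :=
  ⟨fun hi => hi j List.mem_cons_self, fun hij => List.forall_mem_cons.2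
    ⟨hij, fun l hl => hij.trans (h l hl)⟩⟩

theorem not_fits_cons_of_lt (h : K.Fits j) (hji : j < i) : ¬ (cons j K h).Fits i := by
  rw [fits_cons_iff, not_precedes_iff]
  exact Or.inl hji

theorem not_fits_cons_self (h : K.Fits i) (hi : ¬ q i) : ¬ (cons i K h).Fits i := by
  rw [fits_cons_iff, not_precedes_iff]
  exact Or.inr ⟨rfl, hi⟩

theorem fits_or_exists_cons (i : ι) (K : NormalWord q) :
    K.Fits i ∨ ∃ l J, ∃ h : J.Fits l, K = cons l J h ∧ (l < i ∨ l = i ∧ ¬ q i) := by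
  obtain ⟨_ | ⟨l, J⟩, hK⟩ := K
  · exact Or.inl (fits_nil i)
  · obtain ⟨h, hJ⟩ := List.pairwise_cons.1 hK
    refine or_iff_not_imp_left.2 fun hi => ⟨l, ⟨J, hJ⟩, h, rfl, ?_⟩
    have hil : ¬ Precedes q i l := mt (fits_cons_iff (K := ⟨J, hJ⟩) h).2 hi
    exact (not_precedes_iff.1 hil).imp_right fun ⟨h, hq⟩ => ⟨h.symm, hq⟩

theorem Fits.of_perm_cons (h : J.Fits l) (hli : l < i) (hK : K.toList.Perm (i :: J.toList)) :
    K.Fits l :=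
  fun j hj => (List.mem_cons.1 (hK.subset hj)).elim (fun hj => hj ▸ Or.inl hli) (h j)

end NormalWord

end NormalWord

section SortedWord

variable {n : ℕ} {q : Fin n → Prop}

/-- The sorted word in which the letter `r` occurs `J r` times. -/
def sortedWord (J : Fin n → ℕ) : List (Fin n) :=
  (List.finRange n).flatMap fun r => List.replicate (J r) r

theorem count_sortedWord (J : Fin n → ℕ) (r : Fin n) : (sortedWord J).count r = J r := by
  rw [sortedWord, List.count_flatMap, ← List.ofFn_eq_map, List.sum_ofFn]
  simp [List.count_replicate]

theorem prod_map_sortedWord {M : Type*} [Monoid M] (J : Fin n → ℕ) (z : Fin n → M) :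
    ((sortedWord J).map z).prod = (List.ofFn fun r => z r ^ J r).prod := by
  simp [sortedWord, List.ofFn_eq_map, List.flatMap_def, List.map_flatten, List.prod_flatten,
    Function.comp_def]

theorem pairwise_sortedWord {J : Fin n → ℕ} (hJ : ∀ r, ¬ q r → J r ≤ 1) :
    (sortedWord J).Pairwise (Precedes q) := by
  refine List.pairwise_flatMap.2 ⟨fun r _ => List.pairwise_replicate.2 ?_,
    (List.pairwise_lt_finRange n).imp fun hab a ha b hb => ?_⟩
  · exact or_iff_not_imp_left.2 fun h => Or.inr ⟨rfl, not_not.1 (mt (hJ r) h)⟩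
  · rw [List.eq_of_mem_replicate ha, List.eq_of_mem_replicate hb]
    exact Or.inl hab

theorem NormalWord.count_le_one (K : NormalWord q) {r : Fin n} (hr : ¬ q r) :
    K.toList.count r ≤ 1 := by
  by_contra! h
  have hrr := K.pairwise.sublist (List.replicate_sublist_iff.2 h)
  exact ((List.pairwise_cons.1 hrr).1 r (by simp)).elim (lt_irrefl r) fun h => hr h.2

/-- Normal words correspond to exponent vectors. -/
def NormalWord.equivExponent : {J : Fin n → ℕ // ∀ r, ¬ q r → J r ≤ 1} ≃ NormalWord q where
  toFun J := ⟨sortedWord J.1, pairwise_sortedWord J.2⟩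
  invFun K := ⟨fun r => K.toList.count r, fun _ => K.count_le_one⟩
  left_inv J := Subtype.ext (funext (count_sortedWord J.1))
  right_inv K := NormalWord.ext <|
    (List.perm_iff_count.2 (count_sortedWord _)).eq_of_pairwise (fun _ _ _ _ => Precedes.antisymm)
      (pairwise_sortedWord fun _ => K.count_le_one) K.pairwise

end SortedWord

/-- The data of a presentation, over a `k`-algebra `R`, of an algebra with generators `y i` and
relations `y i * a = σ i a * y i + δ i a` for `a : R` and
`y i * y j = s i j • y j * y i + ∑ r, c i j r * y r`. -/
structure SkewPresentation (k R ι : Type*) [Field k] [Ring R] [Algebra k R] where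
  /-- the commutation factors -/
  s : ι → ι → k
  /-- the twists -/
  σ : ι → R →ₐ[k] R
  /-- the skew derivations -/
  δ : ι → R →ₗ[k] R
  /-- the structure constants: `c i j r` is the coefficient of `y r` -/
  c : ι → ι → ι → R
  s_mul_s_swap : ∀ i j, s i j * s j i = 1
  δ_mul : ∀ i a b, δ i (a * b) = δ i a * b + σ i a * δ i b

namespace SkewPresentation

section General

variable {k R ι : Type*} [Field k] [Ring R] [Algebra k R] (D : SkewPresentation k R ι)

theorem δ_one (i : ι) : D.δ i 1 = 0 := by
  simpa using D.δ_mul i 1 1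

theorem s_self_eq_neg_one {i : ι} (hi : D.s i i ≠ 1) : D.s i i = -1 :=
  (mul_self_eq_one_iff.1 (D.s_mul_s_swap i i)).resolve_left hi

theorem two_ne_zero {i : ι} (hi : D.s i i ≠ 1) : (2 : k) ≠ 0 := fun h =>
  hi ((D.s_self_eq_neg_one hi).trans (by linear_combination -h))

section IsSkew

variable {N M : Type*} [AddCommGroup N] [Module k N] [Module R N]
  [AddCommGroup M] [Module k M] [Module R M]

/-- `F` obeys the rule for moving `y i` past a scalar, relative to the linear map `h`; for `h = id`
this says that `F` can be the action of `y i` on a module. -/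
def IsSkew (i : ι) (h : N →ₗ[R] M) (F : N →ₗ[k] M) : Prop :=
  ∀ (a : R) (m : N), F (a • m) = D.σ i a • F m + D.δ i a • h m

variable {D} {i : ι} {h : N →ₗ[R] M} {F G : N →ₗ[k] M}

theorem IsSkew.eqOn_span (hF : D.IsSkew i h F) (hG : D.IsSkew i h G) {S : Set N}
    (hS : Set.EqOn F G S) : Set.EqOn F G (Submodule.span R S) := fun m hm => by
  induction hm using Submodule.span_induction with
  | mem m hm => exact hS hm
  | zero => rw [map_zero, map_zero]
  | add m m' _ _ ih ih' => rw [map_add, map_add, ih, ih']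
  | smul a m _ ih => rw [hF, hG, ih]

theorem IsSkew.mem_of_mem_span (hF : D.IsSkew i h F) {S : Set N} {P : Submodule R M}
    (hS : ∀ m ∈ S, h m ∈ P ∧ F m ∈ P) {m : N} (hm : m ∈ Submodule.span R S) :
    h m ∈ P ∧ F m ∈ P := by
  induction hm using Submodule.span_induction with
  | mem m hm => exact hS m hm
  | zero => simp
  | add m m' _ _ ih ih' =>
    rw [map_add, map_add]
    exact ⟨P.add_mem ih.1 ih'.1, P.add_mem ih.2 ih'.2⟩
  | smul a m _ ih =>
    rw [map_smul, hF]
    exact ⟨P.smul_mem _ ih.1, P.add_mem (P.smul_mem _ ih.2) (P.smul_mem _ ih.1)⟩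

end IsSkew

end General

section Finite

variable {k R ι : Type*} [Field k] [Ring R] [Algebra k R] [Fintype ι] (D : SkewPresentation k R ι)

/-- The coefficients of the skew commutator of `y i` and `∑ r, v r * y r`. -/
def ad (i : ι) (v : ι → R) : ι → R :=
  fun t => D.δ i (v t) + ∑ r, D.σ i (v r) * D.c i r t

/-- The conditions under which the ordered monomials in the `y i` are independent over `R`. The
diagonal conditions `c_self` and `jacobi_self` are the instances of `c_antisymm` and `jacobi` that
get lost in characteristic `2` and `3` respectively. -/
structure IsConsistent : Prop where
  σ_comm : ∀ i j a, D.σ i (D.σ j a) = D.σ j (D.σ i a)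
  δ_σ : ∀ i j a, D.δ i (D.σ j a) = D.s i j • D.σ j (D.δ i a)
  δ_δ : ∀ i j a, D.δ i (D.δ j a) = D.s i j • D.δ j (D.δ i a) + ∑ r, D.c i j r * D.δ r a
  σ_σ_mul_c : ∀ i j r a, D.σ i (D.σ j a) * D.c i j r = D.c i j r * D.σ r a
  σ_c : ∀ i j l r, D.s i r • D.σ i (D.c j l r) = (D.s i j * D.s i l) • D.c j l r
  c_antisymm : ∀ i j, D.c i j = -(D.s i j • D.c j i)
  c_self : ∀ i, D.s i i = 1 → D.c i i = 0
  jacobi : ∀ i j l, D.ad i (D.c j l) - D.s i j • D.ad j (D.c i l) +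
    (D.s i l * D.s j l) • D.ad l (D.c i j) = 0
  jacobi_self : ∀ i, D.s i i ≠ 1 → D.ad i (D.c i i) = 0

variable {D} in
theorem IsConsistent.σ_δ (hD : D.IsConsistent) (i j : ι) (a : R) :
    D.σ i (D.δ j a) = D.s i j • D.δ j (D.σ i a) := by
  rw [hD.δ_σ, smul_smul, D.s_mul_s_swap, one_smul]

section CommAt

variable {M : Type*} [AddCommGroup M] [Module k M] [Module R M] [IsScalarTower k R M]

/-- The operators `T i` satisfy the relation between `y i` and `y j` at the vector `m`. -/
def CommAt (T : ι → Module.End k M) (i j : ι) (m : M) : Prop :=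
  T i (T j m) = D.s i j • T j (T i m) + Fintype.linearCombination R T (D.c i j) m

/-- The operators `T i` turn the `R`-module `M` into a module over the presented algebra. -/
structure IsRep (T : ι → Module.End k M) : Prop where
  isSkew : ∀ i, D.IsSkew i .id (T i)
  commAt : ∀ i j m, D.CommAt T i j m

variable {D} {T : ι → Module.End k M} {i j l : ι} {m : M}

theorem linearCombination_apply_apply (v : ι → R) (m : M) :
    Fintype.linearCombination R T v m = ∑ r, v r • T r m := by
  simp [Fintype.linearCombination_apply]

theorem linearCombination_c_self_apply (hi : D.s i i ≠ 1) (h : D.CommAt T i i m) :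
    Fintype.linearCombination R T (D.c i i) m = (2 : k) • T i (T i m) := by
  rw [CommAt, D.s_self_eq_neg_one hi] at h
  linear_combination (norm := module) -h

theorem commAt_self_of_linearCombination (hi : D.s i i ≠ 1)
    (h : T i (T i m) = (2⁻¹ : k) • Fintype.linearCombination R T (D.c i i) m) :
    D.CommAt T i i m := by
  rw [CommAt, D.s_self_eq_neg_one hi, neg_smul, one_smul, eq_neg_add_iff_add_eq, ← two_smul k, h,
    smul_inv_smul₀ (D.two_ne_zero hi)]

theorem IsConsistent.commAt_self (hD : D.IsConsistent) (hi : D.s i i = 1) : D.CommAt T i i m := by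
  simp [CommAt, hi, hD.c_self i hi]

theorem IsConsistent.commAt_symm (hD : D.IsConsistent) (h : D.CommAt T i j m) :
    D.CommAt T j i m := by
  rw [CommAt] at h ⊢
  rw [h, hD.c_antisymm i j, map_neg, LinearMap.map_smul_of_tower, LinearMap.neg_apply,
    LinearMap.smul_apply, smul_add, smul_neg, smul_smul, smul_smul, D.s_mul_s_swap]
  module

theorem IsConsistent.commAt_smul (hD : D.IsConsistent) (hT : ∀ i, D.IsSkew i .id (T i))
    (h : D.CommAt T i j m) (a : R) : D.CommAt T i j (a • m) := by
  have hT' (i : ι) (a : R) (m : M) : T i (a • m) = D.σ i a • T i m + D.δ i a • m := hT i a m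
  have hc : Fintype.linearCombination R T (D.c i j) (a • m) =
      D.σ i (D.σ j a) • Fintype.linearCombination R T (D.c i j) m +
        (∑ r, D.c i j r * D.δ r a) • m := by
    simp only [linearCombination_apply_apply, hT', smul_add, smul_smul, Finset.sum_add_distrib,
      Finset.smul_sum, Finset.sum_smul, hD.σ_σ_mul_c]
  rw [CommAt] at h ⊢
  rw [hc]
  simp only [hT', map_add, h, hD.δ_δ i j a, hD.δ_σ i j a, hD.σ_δ i j a, smul_add, add_smul,
    smul_assoc, hD.σ_comm j i a, smul_comm (D.s i j) (D.σ i (D.σ j a))]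
  abel

theorem IsConsistent.commAt_of_mem_span (hD : D.IsConsistent) (hT : ∀ i, D.IsSkew i .id (T i))
    {S : Set M} (hS : ∀ m ∈ S, D.CommAt T i j m) (hm : m ∈ Submodule.span R S) :
    D.CommAt T i j m := by
  induction hm using Submodule.span_induction with
  | mem m hm => exact hS m hm
  | zero => simp [CommAt]
  | add m m' _ _ h h' =>
    rw [CommAt] at h h' ⊢
    simp only [map_add, h, h', smul_add]
    abel
  | smul a m _ h => exact hD.commAt_smul hT h a

theorem IsConsistent.apply_linearCombination_c (hD : D.IsConsistent)
    (hT : ∀ i, D.IsSkew i .id (T i)) (h : ∀ r, D.CommAt T i r m) :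
    T i (Fintype.linearCombination R T (D.c j l) m) =
      (D.s i j * D.s i l) • Fintype.linearCombination R T (D.c j l) (T i m) +
        Fintype.linearCombination R T (D.ad i (D.c j l)) m := by
  have hσ : (D.s i j * D.s i l) • Fintype.linearCombination R T (D.c j l) (T i m) =
      ∑ r, D.s i r • D.σ i (D.c j l r) • T r (T i m) := by
    simp only [linearCombination_apply_apply, Finset.smul_sum, ← smul_assoc, hD.σ_c]
  have had : Fintype.linearCombination R T (D.ad i (D.c j l)) m =
      ∑ r, (D.δ i (D.c j l r) • T r m +
        D.σ i (D.c j l r) • Fintype.linearCombination R T (D.c i r) m) := by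
    simp only [linearCombination_apply_apply, ad, add_smul, Finset.sum_add_distrib,
      Finset.smul_sum, Finset.sum_smul, smul_smul]
    rw [Finset.sum_comm]
  rw [hσ, had, ← Finset.sum_add_distrib, linearCombination_apply_apply, map_sum]
  refine Finset.sum_congr rfl fun r _ => ?_
  rw [hT i, h r, smul_add, smul_comm (D.s i r), LinearMap.id_apply]
  abel

theorem IsConsistent.linearCombination_jacobi (hD : D.IsConsistent) (i j l : ι) (m : M) :
    Fintype.linearCombination R T (D.ad i (D.c j l)) m -
      D.s i j • Fintype.linearCombination R T (D.ad j (D.c i l)) m +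
      (D.s i l * D.s j l) • Fintype.linearCombination R T (D.ad l (D.c i j)) m = 0 := by
  have h := congrArg (fun v => Fintype.linearCombination R T v m) (hD.jacobi i j l)
  simpa only [map_add, map_sub, LinearMap.map_smul_of_tower, map_zero, LinearMap.add_apply,
    LinearMap.sub_apply, LinearMap.smul_apply, LinearMap.zero_apply] using h

-- Rewriting `y i * y j * y l` in the two possible ways leaves the Jacobi identity of `c`.
theorem IsConsistent.commAt_apply (hD : D.IsConsistent) (hT : ∀ i, D.IsSkew i .id (T i))
    (h : ∀ i j, D.CommAt T i j m) (hil : D.CommAt T i l (T j m)) (hjl : D.CommAt T j l (T i m)) :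
    D.CommAt T i j (T l m) := by
  have hjac := hD.linearCombination_jacobi (T := T) i j l m
  have hs : D.s i l * D.s j l * (D.s l i * D.s l j) = 1 := by
    linear_combination (D.s i l * D.s l i) * D.s_mul_s_swap j l + D.s_mul_s_swap i l
  have hjl' := h j l
  have hil' := h i l
  have hij' := h i j
  rw [CommAt] at hil hjl hjl' hil' hij' ⊢
  rw [hjl', hil']
  simp only [map_add, map_smul, hil, hjl, hD.apply_linearCombination_c hT (h _), hij']
  linear_combination (norm := module)
    hjac + hs • Fintype.linearCombination R T (D.c i j) (T l m) -
      D.s_mul_s_swap i j • D.s j l • Fintype.linearCombination R T (D.c i l) (T j m)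

-- The overlap `y i * y j * y j`: `y j * y j` is known only through its double, so both sides are
-- compared after doubling.
theorem IsConsistent.commAt_apply_right (hD : D.IsConsistent) (hT : ∀ i, D.IsSkew i .id (T i))
    (hj : D.s j j ≠ 1) (h : ∀ i j, D.CommAt T i j m) (hjj : D.CommAt T j j (T i m)) :
    D.CommAt T i j (T j m) := by
  have hjac := hD.linearCombination_jacobi (T := T) i j j m
  have hsq := congrArg (T i) (linearCombination_c_self_apply hj (h j j))
  have hij := congrArg (T j) (h i j)
  have hs := D.s_mul_s_swap i j
  rw [map_add, map_smul] at hij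
  simp only [map_smul, hD.apply_linearCombination_c hT (h _), D.s_self_eq_neg_one hj,
    linearCombination_c_self_apply hj hjj] at hsq hij hjac
  refine smul_right_injective M (D.two_ne_zero hj) ?_
  linear_combination (norm := module) -hsq - (2 * D.s i j) • hij + hjac +
    (2 * hs) • Fintype.linearCombination R T (D.c i j) (T j m)

theorem IsConsistent.commAt_apply_self (hD : D.IsConsistent) (hT : ∀ i, D.IsSkew i .id (T i))
    (hi : D.s i i ≠ 1) (h : ∀ i j, D.CommAt T i j m) : D.CommAt T i i (T i m) := by
  have hsq := congrArg (T i) (linearCombination_c_self_apply hi (h i i))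
  rw [hD.apply_linearCombination_c hT (h i), hD.jacobi_self i hi, D.s_self_eq_neg_one hi, map_smul,
    map_zero, LinearMap.zero_apply, neg_mul_neg, mul_one, one_smul, add_zero] at hsq
  rw [CommAt, hsq, D.s_self_eq_neg_one hi]
  module

end CommAt

end Finite

section FreeModule

open Finsupp

variable {k R ι : Type*} [Field k] [Ring R] [Algebra k R] [LinearOrder ι]
  (D : SkewPresentation k R ι)

/-- The words indexing the basis: `y i` may be repeated unless `s i i ≠ 1`, when `y i * y i` is
already determined by the relations. -/
abbrev Word : Type _ := NormalWord fun i => D.s i i = 1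

/-- The free left `R`-module on the normal words. -/
abbrev Mod : Type _ := D.Word →₀ R

/-- The basis vector of `D.Mod` belonging to a word. -/
noncomputable def e (K : D.Word) : D.Mod := single K 1

/-- The skew operator with prescribed values on the basis. -/
noncomputable def skewExt (i : ι) (f : D.Word → D.Mod) : Module.End k D.Mod :=
  Finsupp.lsum k fun K =>
    (LinearMap.toSpanSingleton R D.Mod (f K)).restrictScalars k ∘ₗ (D.σ i).toLinearMap +
      lsingle K ∘ₗ D.δ i

theorem skewExt_single (i : ι) (f : D.Word → D.Mod) (K : D.Word) (a : R) :
    D.skewExt i f (single K a) = D.σ i a • f K + single K (D.δ i a) := by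
  simp [skewExt]

@[simp] theorem skewExt_e (i : ι) (f : D.Word → D.Mod) (K : D.Word) :
    D.skewExt i f (D.e K) = f K := by
  simp [e, skewExt_single, δ_one]

theorem isSkew_skewExt (i : ι) (f : D.Word → D.Mod) : D.IsSkew i .id (D.skewExt i f) := by
  intro a m
  induction m using Finsupp.induction_linear with
  | zero => simp
  | add m m' h h' => simp only [smul_add, map_add, h, h']; abel
  | single K b =>
    simp only [smul_single, skewExt_single, smul_eq_mul, map_mul, D.δ_mul, smul_add, smul_smul,
      single_add, LinearMap.id_apply]
    abel

section IsSkew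

variable {M : Type*} [AddCommGroup M] [Module k M] [Module R M]
  {D} {i : ι} {h : D.Mod →ₗ[R] M} {F G : D.Mod →ₗ[k] M} {S : Set D.Word} {m : D.Mod}

theorem IsSkew.eq_of_mem_supported (hF : D.IsSkew i h F) (hG : D.IsSkew i h G)
    (hS : ∀ K ∈ S, F (D.e K) = G (D.e K)) (hm : m ∈ supported R R S) : F m = G m := by
  rw [supported_eq_span_single] at hm
  refine hF.eqOn_span hG ?_ hm
  rintro _ ⟨K, hK, rfl⟩
  exact hS K hK

theorem IsSkew.mem_of_mem_supported (hF : D.IsSkew i h F) {P : Submodule R M}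
    (hS : ∀ K ∈ S, h (D.e K) ∈ P ∧ F (D.e K) ∈ P) (hm : m ∈ supported R R S) : F m ∈ P := by
  rw [supported_eq_span_single] at hm
  refine (hF.mem_of_mem_span ?_ hm).2
  rintro _ ⟨K, hK, rfl⟩
  exact hS K hK

end IsSkew

section LeadingWords

/-- The words that can occur in `y i • e K`. -/
def leadingWords (i : ι) (K : D.Word) : Set D.Word :=
  {K' | K'.length ≤ K.length ∨ K'.toList.Perm (i :: K.toList)}

variable {D} {i l : ι} {J K : D.Word}

theorem length_le_of_mem_leadingWords (hK : K ∈ D.leadingWords i J) :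
    K.length ≤ J.length + 1 :=
  hK.elim Nat.le_succ_of_le fun hK => hK.length_eq.le

theorem length_le_or_fits_of_mem_leadingWords (h : J.Fits l) (hl : l < i)
    (hK : K ∈ D.leadingWords i J) : K.length ≤ J.length ∨ K.Fits l :=
  hK.imp_right (h.of_perm_cons hl)

end LeadingWords

section Eval

variable {M : Type*} [AddCommGroup M] [Module k M] [Module R M]
  (T : ι → Module.End k M) (m₀ : M)

/-- The `R`-linear map sending the basis vector of the word `i₁ ⋯ iₗ` to `T i₁ (⋯ (T iₗ m₀))`. -/
noncomputable def eval : D.Mod →ₗ[R] M :=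
  Finsupp.linearCombination R fun K => (K.toList.map T).prod m₀

@[simp] theorem eval_e (K : D.Word) : D.eval T m₀ (D.e K) = (K.toList.map T).prod m₀ := by
  simp [eval, e]

end Eval

variable [Fintype ι]

open Classical in
/-- The value of `y i` on the basis vector of a word, found by straightening: a letter `l < i` is
moved to the front, and a repeated letter `i` with `s i i ≠ 1` is removed by means of
`2 * y i * y i = ∑ r, c i i r * y r`. The junk value `0` is never used, because all words in
`y i • e J` either are no longer than `J` or fit `l`. -/
noncomputable def straighten : D.Word → ι → D.Mod
  | ⟨[], _⟩, i => D.e (NormalWord.nil.cons i (NormalWord.fits_nil i))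
  | ⟨l :: J, hJ⟩, i =>
    let J' : D.Word := ⟨J, hJ.of_cons⟩
    if h : NormalWord.Fits i ⟨l :: J, hJ⟩ then D.e (NormalWord.cons i ⟨l :: J, hJ⟩ h)
    else if l = i then (2⁻¹ : k) • ∑ r, D.c i i r • straighten J' r
    else
      D.s i l • D.skewExt l (fun K => if h : K.Fits l then D.e (K.cons l h)
        else if K.length < J.length + 1 then straighten K l else 0) (straighten J' i) +
      ∑ r, D.c i l r • straighten J' r
termination_by K => K.length
decreasing_by all_goals simp_all [NormalWord.length]

/-- The action of the generator `y i` on the free module. -/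
noncomputable def Y (i : ι) : Module.End k D.Mod :=
  D.skewExt i fun K => D.straighten K i

theorem isSkew_Y (i : ι) : D.IsSkew i .id (D.Y i) :=
  D.isSkew_skewExt i _

variable {D} {i l : ι} {J K : D.Word}

theorem Y_e_of_fits (h : K.Fits i) : D.Y i (D.e K) = D.e (K.cons i h) := by
  rw [Y, skewExt_e]
  obtain ⟨_ | _, _⟩ := K
  · rw [straighten]; rfl
  · rw [straighten, dif_pos h]

theorem Y_e_cons_self (h : J.Fits i) (hi : D.s i i ≠ 1) :
    D.Y i (D.e (J.cons i h)) =
      (2⁻¹ : k) • Fintype.linearCombination R D.Y (D.c i i) (D.e J) := by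
  have hf := NormalWord.not_fits_cons_self h hi
  rw [linearCombination_apply_apply]
  simp only [Y, skewExt_e, NormalWord.cons] at hf ⊢
  rw [straighten, dif_neg hf, if_pos rfl]

theorem Y_e_cons_of_lt (h : J.Fits l) (hl : l < i)
    (hJ : D.Y i (D.e J) ∈ supported R R (D.leadingWords i J)) :
    D.Y i (D.e (J.cons l h)) = D.s i l • D.Y l (D.Y i (D.e J)) +
      Fintype.linearCombination R D.Y (D.c i l) (D.e J) := by
  have hf := NormalWord.not_fits_cons_of_lt h hl
  have hlow := fun K => length_le_or_fits_of_mem_leadingWords (D := D) (K := K) h hl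
  rw [linearCombination_apply_apply]
  simp only [Y, skewExt_e, NormalWord.cons] at hf hJ ⊢
  rw [straighten, dif_neg hf, if_neg hl.ne]
  congr 2
  refine (D.isSkew_skewExt l _).eq_of_mem_supported (D.isSkew_Y l) (fun K hK => ?_) hJ
  rw [skewExt_e]
  split_ifs with hKl hlen
  · exact (Y_e_of_fits hKl).symm
  · rw [skewExt_e]
  · exact absurd (Nat.lt_succ_of_le ((hlow K hK).resolve_right hKl)) hlen

theorem linearCombination_Y_e_mem {P : Submodule R D.Mod} (v : ι → R)
    (h : ∀ r, D.Y r (D.e J) ∈ P) : Fintype.linearCombination R D.Y v (D.e J) ∈ P := by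
  rw [linearCombination_apply_apply]
  exact P.sum_mem fun r _ => P.smul_mem _ (h r)

theorem Y_e_mem_supported (i : ι) (K : D.Word) :
    D.Y i (D.e K) ∈ supported R R (D.leadingWords i K) := by
  induction hd : K.length using Nat.strong_induction_on generalizing K i with
  | _ d ih =>
  subst hd
  obtain hf | ⟨l, J, h, rfl, hli⟩ := K.fits_or_exists_cons i
  · rw [Y_e_of_fits hf]
    exact single_mem_supported R _ (Or.inr (List.Perm.refl _))
  have ih' (r : ι) := ih J.length (by simp) r J rfl
  have hlin (v : ι → R) : Fintype.linearCombination R D.Y v (D.e J) ∈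
      supported R R (D.leadingWords i (J.cons l h)) :=
    linearCombination_Y_e_mem v fun r => supported_mono
      (fun K hK => Or.inl (by simpa using length_le_of_mem_leadingWords hK)) (ih' r)
  obtain hli | ⟨rfl, hi⟩ := hli
  · rw [Y_e_cons_of_lt h hli (ih' i)]
    refine add_mem (Submodule.smul_of_tower_mem _ _ ?_) (hlin _)
    refine (D.isSkew_Y l).mem_of_mem_supported (fun K hK => ⟨?_, ?_⟩) (ih' i)
    · exact single_mem_supported R _
        (Or.inl (by simpa using length_le_of_mem_leadingWords hK))
    by_cases hKl : K.Fits l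
    · rw [Y_e_of_fits hKl]
      refine single_mem_supported R _ (hK.imp (fun hK => by simpa using hK) fun hK => ?_)
      exact (hK.cons l).trans (List.Perm.swap _ _ _)
    · have hKJ := (length_le_or_fits_of_mem_leadingWords h hli hK).resolve_right hKl
      refine supported_mono (fun K' hK' => Or.inl ?_)
        (ih K.length (by simpa using Nat.lt_succ_of_le hKJ) l K rfl)
      simpa using (length_le_of_mem_leadingWords hK').trans (Nat.succ_le_succ hKJ)
  · rw [Y_e_cons_self h hi]
    exact Submodule.smul_of_tower_mem _ _ (hlin _)

variable {j : ι}

theorem commAt_Y_of_fits (hij : ¬ Precedes (fun i => D.s i i = 1) i j) (hK : K.Fits j) :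
    D.CommAt D.Y i j (D.e K) := by
  obtain hji | ⟨rfl, hi⟩ := not_precedes_iff.1 hij
  · rw [CommAt, Y_e_of_fits hK, Y_e_cons_of_lt hK hji (Y_e_mem_supported i K)]
  · refine commAt_self_of_linearCombination hi ?_
    rw [Y_e_of_fits hK, Y_e_cons_self hK hi]

theorem IsConsistent.commAt_of_not_precedes {M : Type*} [AddCommGroup M] [Module k M] [Module R M]
    [IsScalarTower k R M] {T : ι → Module.End k M} {m : M} (hD : D.IsConsistent)
    (h : ∀ i j, ¬ Precedes (fun i => D.s i i = 1) i j → D.CommAt T i j m) (i j : ι) :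
    D.CommAt T i j m := by
  by_cases hij : Precedes (fun i => D.s i i = 1) i j
  · by_cases hji : Precedes (fun i => D.s i i = 1) j i
    · obtain rfl := hij.antisymm hji
      exact hD.commAt_self (hij.resolve_left (lt_irrefl i)).2
    · exact hD.commAt_symm (h j i hji)
  · exact h i j hij

theorem IsConsistent.commAt_Y_Y_of_lt (hD : D.IsConsistent)
    (ih : ∀ K : D.Word, K.length ≤ J.length → D.CommAt D.Y i l (D.e K))
    (hil : ¬ Precedes (fun i => D.s i i = 1) i l) (h : J.Fits l) (hlj : l < j) :
    D.CommAt D.Y i l (D.Y j (D.e J)) := by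
  have hm := Y_e_mem_supported j J
  rw [supported_eq_span_single] at hm
  refine hD.commAt_of_mem_span D.isSkew_Y ?_ hm
  rintro _ ⟨K, hK, rfl⟩
  exact (length_le_or_fits_of_mem_leadingWords h hlj hK).elim (ih K) (commAt_Y_of_fits hil)

theorem IsConsistent.commAt_Y_e (hD : D.IsConsistent) (K : D.Word) (i j : ι) :
    D.CommAt D.Y i j (D.e K) := by
  induction hd : K.length using Nat.strong_induction_on generalizing K i j with
  | _ d ih =>
  subst hd
  refine hD.commAt_of_not_precedes (fun i j hij => ?_) i j
  obtain hK | ⟨l, J, h, rfl, hlj⟩ := K.fits_or_exists_cons j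
  · exact commAt_Y_of_fits hij hK
  have hlt {K : D.Word} (hK : K.length ≤ J.length) (i j : ι) : D.CommAt D.Y i j (D.e K) :=
    ih K.length (by simpa using Nat.lt_succ_of_le hK) K i j rfl
  have hlow {i j : ι} (hil : ¬ Precedes (fun i => D.s i i = 1) i l) (hlj : l < j) :
      D.CommAt D.Y i l (D.Y j (D.e J)) :=
    hD.commAt_Y_Y_of_lt (fun K hK => hlt hK i l) hil h hlj
  rw [← Y_e_of_fits h]
  obtain hlj | ⟨rfl, hl⟩ := hlj
  · have hli : l < i := (not_precedes_iff.1 hij).elim hlj.trans fun h => h.1 ▸ hlj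
    exact hD.commAt_apply D.isSkew_Y (hlt le_rfl) (hlow (not_precedes_iff.2 (Or.inl hli)) hlj)
      (hlow (not_precedes_iff.2 (Or.inl hlj)) hli)
  · obtain hli | ⟨rfl, -⟩ := not_precedes_iff.1 hij
    · exact hD.commAt_apply_right D.isSkew_Y hl (hlt le_rfl)
        (hlow (not_precedes_iff.2 (Or.inr ⟨rfl, hl⟩)) hli)
    · exact hD.commAt_apply_self D.isSkew_Y hl (hlt le_rfl)

theorem IsConsistent.isRep_Y (hD : D.IsConsistent) : D.IsRep D.Y where
  isSkew := D.isSkew_Y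
  commAt i j m := by
    refine hD.commAt_of_mem_span (S := Set.range D.e) D.isSkew_Y ?_ ?_
    · rintro _ ⟨K, rfl⟩
      exact hD.commAt_Y_e K i j
    · have hm : m ∈ supported R R (Set.univ : Set D.Word) := by simp
      rwa [supported_eq_span_single, Set.image_univ] at hm

section IsRep

variable {M : Type*} [AddCommGroup M] [Module k M] [Module R M]
  {T : ι → Module.End k M} {m₀ : M}

theorem eval_Y_e_of_fits (h : K.Fits i) :
    D.eval T m₀ (D.Y i (D.e K)) = T i (D.eval T m₀ (D.e K)) := by
  simp [Y_e_of_fits h, NormalWord.cons]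

variable [IsScalarTower k R M]

theorem IsRep.eval_Y_of_mem_supported (hT : D.IsRep T) {S : Set D.Word}
    (hS : ∀ K ∈ S, D.eval T m₀ (D.Y i (D.e K)) = T i (D.eval T m₀ (D.e K))) {m : D.Mod}
    (hm : m ∈ supported R R S) : D.eval T m₀ (D.Y i m) = T i (D.eval T m₀ m) := by
  let f := (D.eval T m₀).restrictScalars k
  have hl : D.IsSkew i (D.eval T m₀) (f ∘ₗ D.Y i) := fun a m => by
    simp [f, D.isSkew_Y i a m]
  have hr : D.IsSkew i (D.eval T m₀) (T i ∘ₗ f) := fun a m => by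
    simp [f, hT.isSkew i a]
  exact hl.eq_of_mem_supported hr hS hm

theorem IsRep.eval_Y_e (hT : D.IsRep T) (i : ι) (K : D.Word) :
    D.eval T m₀ (D.Y i (D.e K)) = T i (D.eval T m₀ (D.e K)) := by
  induction hd : K.length using Nat.strong_induction_on generalizing K i with
  | _ d ih =>
  subst hd
  obtain hK | ⟨l, J, h, rfl, hli⟩ := K.fits_or_exists_cons i
  · exact eval_Y_e_of_fits hK
  have hlt {K : D.Word} (hK : K.length ≤ J.length) (i : ι) :=
    ih K.length (by simpa using Nat.lt_succ_of_le hK) i K rfl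
  have hlin (v : ι → R) : D.eval T m₀ (Fintype.linearCombination R D.Y v (D.e J)) =
      Fintype.linearCombination R T v (D.eval T m₀ (D.e J)) := by
    simp only [linearCombination_apply_apply, map_sum, map_smul, hlt le_rfl]
  have hcons : D.eval T m₀ (D.e (J.cons l h)) = T l (D.eval T m₀ (D.e J)) := by
    rw [← Y_e_of_fits h, eval_Y_e_of_fits h]
  rw [hcons]
  obtain hli | ⟨rfl, hl⟩ := hli
  · have hJ := Y_e_mem_supported i J
    have hlow : D.eval T m₀ (D.Y l (D.Y i (D.e J))) = T l (D.eval T m₀ (D.Y i (D.e J))) :=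
      hT.eval_Y_of_mem_supported (fun K hK => (length_le_or_fits_of_mem_leadingWords h hli hK).elim
        (fun hK => hlt hK l) eval_Y_e_of_fits) hJ
    rw [Y_e_cons_of_lt h hli hJ, map_add, LinearMap.map_smul_of_tower, hlow, hlt le_rfl, hlin,
      hT.commAt i l]
  · rw [Y_e_cons_self h hl, LinearMap.map_smul_of_tower, hlin,
      linearCombination_c_self_apply hl (hT.commAt l l _), inv_smul_smul₀ (D.two_ne_zero hl)]

theorem IsRep.eval_Y (hT : D.IsRep T) (i : ι) (m : D.Mod) :
    D.eval T m₀ (D.Y i m) = T i (D.eval T m₀ m) :=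
  hT.eval_Y_of_mem_supported (S := Set.univ) (fun K _ => hT.eval_Y_e i K) (by simp)

end IsRep

end FreeModule

section PBWBasis

open Finsupp

variable {k R ι B : Type*} [Field k] [Ring R] [Algebra k R] [Ring B] [Algebra k B] {y : ι → B}

theorem prod_map_lmul_one (l : List ι) :
    (l.map fun i => Algebra.lmul k B (y i)).prod 1 = (l.map y).prod := by
  have h := map_list_prod (Algebra.lmul k B) (l.map y)
  rw [List.map_map] at h
  exact (congrArg (· 1) h).symm.trans (mul_one _)

variable {D : SkewPresentation k R ι} [Fintype ι] [Module R B] [IsScalarTower R B B]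

theorem isRep_lmul (hyx : ∀ i (a : R), y i * a • 1 = D.σ i a • y i + D.δ i a • 1)
    (hyy : ∀ i j, y i * y j = D.s i j • (y j * y i) + ∑ r, D.c i j r • y r) [IsScalarTower k R B] :
    D.IsRep fun i => Algebra.lmul k B (y i) where
  isSkew i a b := by
    simpa [add_mul, mul_assoc, smul_mul_assoc] using congrArg (· * b) (hyx i a)
  commAt i j b := by
    simpa [CommAt, linearCombination_apply_apply, add_mul, mul_assoc, smul_mul_assoc,
      Finset.sum_mul] using congrArg (· * b) (hyy i j)

variable [LinearOrder ι]

theorem IsRep.eval_lmul_surjective [IsScalarTower k R B]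
    (hy : D.IsRep fun i => Algebra.lmul k B (y i))
    (hgen : Algebra.adjoin k (Set.range (fun a : R => (a • 1 : B)) ∪ Set.range y) = ⊤) :
    Function.Surjective (D.eval (fun i => Algebra.lmul k B (y i)) 1) := by
  let E := D.eval (fun i => Algebra.lmul k B (y i)) 1
  have hmul (b : B) : ∀ m, b * E m ∈ LinearMap.range E := by
    induction hgen ▸ Algebra.mem_top (R := k) (x := b) using Algebra.adjoin_induction with
    | mem b hb =>
      intro m
      rcases hb with ⟨a, rfl⟩ | ⟨i, rfl⟩
      · exact ⟨a • m, by simp⟩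
      · exact ⟨D.Y i m, hy.eval_Y i m⟩
    | algebraMap t => exact fun m => ⟨t • m, by rw [LinearMap.map_smul_of_tower, Algebra.smul_def]⟩
    | add b b' _ _ h h' =>
      exact fun m => add_mul b b' (E m) ▸ add_mem (h m) (h' m)
    | mul b b' _ _ h h' =>
      intro m
      obtain ⟨m', hm'⟩ := h' m
      rw [mul_assoc, ← hm']
      exact h m'
  intro b
  simpa [E, NormalWord.nil] using hmul b (D.e NormalWord.nil)

theorem prod_map_Y_e_nil (K : D.Word) : (K.toList.map D.Y).prod (D.e NormalWord.nil) = D.e K := by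
  obtain ⟨K, hK⟩ := K
  induction K with
  | nil => rfl
  | cons i K ih =>
    have h := List.pairwise_cons.1 hK
    rw [List.map_cons, List.prod_cons, Module.End.mul_apply, ih h.2]
    exact Y_e_of_fits (K := ⟨K, h.2⟩) h.1

theorem eval_lmul_injective (ρ : B →ₐ[k] Module.End k D.Mod)
    (hρ : ∀ (a : R) m, ρ (a • 1) m = a • m) (hρy : ∀ i, ρ (y i) = D.Y i) :
    Function.Injective (D.eval (fun i => Algebra.lmul k B (y i)) 1) := by
  refine Function.LeftInverse.injective (g := fun b => ρ b (D.e NormalWord.nil)) fun m => ?_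
  induction m using Finsupp.induction_linear with
  | zero => simp
  | add m m' h h' => simpa using congrArg₂ (· + ·) h h'
  | single K a =>
    have hK : single K a = a • D.e K := by simp [e]
    dsimp only
    rw [hK, map_smul, eval_e, prod_map_lmul_one, ← smul_one_mul, map_mul, Module.End.mul_apply, hρ,
      map_list_prod, List.map_map]
    simp only [Function.comp_def, hρy, prod_map_Y_e_nil]

variable [IsScalarTower k R B] (hy : D.IsRep fun i => Algebra.lmul k B (y i))
  (hgen : Algebra.adjoin k (Set.range (fun a : R => (a • 1 : B)) ∪ Set.range y) = ⊤)
  (ρ : B →ₐ[k] Module.End k D.Mod) (hρ : ∀ (a : R) m, ρ (a • 1) m = a • m)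
  (hρy : ∀ i, ρ (y i) = D.Y i)

/-- The PBW basis: an algebra `B` that is generated over `R` by elements `y i` satisfying the
relations of `D`, and that acts on the free module on the normal words, is free over `R` on the
normal monomials in the `y i`. -/
noncomputable def pbwBasis : Module.Basis D.Word R B :=
  .ofRepr (LinearEquiv.ofBijective (D.eval (fun i => Algebra.lmul k B (y i)) 1)
    ⟨eval_lmul_injective ρ hρ hρy, hy.eval_lmul_surjective hgen⟩).symm

theorem pbwBasis_apply (K : D.Word) :
    pbwBasis hy hgen ρ hρ hρy K = (K.toList.map y).prod := by
  rw [pbwBasis, Module.Basis.coe_ofRepr, LinearEquiv.symm_symm]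
  exact (D.eval_e _ _ K).trans (prod_map_lmul_one K.toList)

end PBWBasis

end SkewPresentation

namespace DGP

section Sign

variable {k : Type*} [DivisionRing k]

theorem neg_one_zpow_mul_neg_one_zpow (a b : ℤ) :
    (-1 : k) ^ a * (-1 : k) ^ b = (-1 : k) ^ (a + b) :=
  (zpow_add₀ (neg_ne_zero.2 one_ne_zero) a b).symm

theorem neg_one_zpow_eq_of_even_sub {a b : ℤ} (h : Even (a - b)) :
    (-1 : k) ^ a = (-1 : k) ^ b := by
  rw [← sub_add_cancel a b, ← neg_one_zpow_mul_neg_one_zpow, h.neg_one_zpow, one_mul]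

theorem neg_one_zpow_mul_self_ne_one_iff (a : ℤ) :
    (-1 : k) ^ (a * a) ≠ 1 ↔ Odd a ∧ (2 : k) ≠ 0 := by
  rcases Int.even_or_odd a with h | h
  · simp [(h.mul_left a).neg_one_zpow, Int.not_odd_iff_even.2 h]
  · rw [(h.mul h).neg_one_zpow, Ne, neg_eq_iff_add_eq_zero, one_add_one_eq_two]
    exact (and_iff_right h).symm

end Sign

variable {k : Type*} [Field k] {n : ℕ} {deg : Fin n → ℤ}

namespace Poly

theorem induction_homogeneous {C : Poly k deg → Prop}
    (homog : ∀ p, ∀ a ∈ comp k deg p, C a) (add : ∀ a b, C a → C b → C (a + b))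
    (a : Poly k deg) : C a :=
  DirectSum.Decomposition.inductionOn (comp k deg) (homog 0 0 (Submodule.zero_mem _))
    (fun m => homog _ m m.2) add a

theorem linearMap_ext {M : Type*} [AddCommMonoid M] [Module k M] {F G : Poly k deg →ₗ[k] M}
    (h : ∀ l : List (Fin n), F (l.map (x k deg)).prod = G (l.map (x k deg)).prod) : F = G := by
  refine LinearMap.ext fun a => ?_
  induction a using induction_homogeneous with
  | homog p a ha =>
    refine LinearMap.eqOn_span ?_ ha
    rintro _ ⟨l, -, rfl⟩
    exact h l
  | add a b ha hb => rw [map_add, map_add, ha, hb]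

theorem adjoin_range_x : Algebra.adjoin k (Set.range (x k deg)) = ⊤ := by
  refine Algebra.eq_top_iff.2 fun a => ?_
  induction a using induction_homogeneous with
  | homog p a ha =>
    refine (Submodule.span_le (p := (Algebra.adjoin k (Set.range (x k deg))).toSubmodule)).2 ?_ ha
    rintro _ ⟨l, -, rfl⟩
    refine Subalgebra.list_prod_mem _ fun b hb => ?_
    obtain ⟨i, -, rfl⟩ := List.mem_map.1 hb
    exact Algebra.subset_adjoin ⟨i, rfl⟩
  | add a b ha hb => exact add_mem ha hb

/-- The automorphism `a ↦ (-1)^{|x_i||a|} a`, the twist in the relations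
`y_i a = ± a y_i + {x_i, a}` of `R^e`. -/
noncomputable def sigma (i : Fin n) : Poly k deg →ₐ[k] Poly k deg :=
  lift k deg (fun j => (-1 : k) ^ (deg i * deg j) • x k deg j) fun j l => by
    simp only [smul_mul_smul_comm, x_comm k deg j l, smul_smul]
    congr 1
    ring

theorem sigma_of_mem (i : Fin n) {p : ℤ} {a : Poly k deg} (ha : a ∈ comp k deg p) :
    sigma i a = (-1 : k) ^ (deg i * p) • a := by
  induction ha using Submodule.span_induction with
  | mem a h =>
    obtain ⟨l, rfl, rfl⟩ := h
    induction l with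
    | nil => simp
    | cons j l ih =>
      rw [List.map_cons, List.prod_cons, List.map_cons, List.sum_cons, map_mul, ih, sigma, lift_x,
        smul_mul_smul_comm, neg_one_zpow_mul_neg_one_zpow, mul_add]
  | zero => simp
  | add a b _ _ h h' => rw [map_add, h, h', smul_add]
  | smul t a _ h => rw [map_smul, h, smul_comm]

theorem sigma_comm (i j : Fin n) (a : Poly k deg) : sigma i (sigma j a) = sigma j (sigma i a) := by
  induction a using induction_homogeneous with
  | homog p a ha => rw [sigma_of_mem j ha, sigma_of_mem i ha, map_smul, map_smul, sigma_of_mem j ha,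
      sigma_of_mem i ha, smul_comm]
  | add a b ha hb => simp only [map_add, ha, hb]

theorem psi_mem (r : Fin n) {p : ℤ} {a : Poly k deg} (ha : a ∈ comp k deg p) :
    psi k deg r a ∈ comp k deg (p - deg r) :=
  (psiMatrix_of_mem k deg r ha).2.2.2

/-- The Leibniz rule of a derivation of degree `m`, written with the values of `F` as right factors
so that it makes sense for `F` that are not homogeneous. Both `ψ_r` and `{·, a}` obey it with
`m = 0`, and `{x_i, ·}` obeys it with `m = |x_i|`. -/
def IsDerivation (m : ℤ) (F : Poly k deg →ₗ[k] Poly k deg) : Prop :=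
  ∀ ⦃p q : ℤ⦄ ⦃a b : Poly k deg⦄, a ∈ comp k deg p → b ∈ comp k deg q →
    F (a * b) = (-1 : k) ^ (m * p) • (a * F b) + (-1 : k) ^ ((m + p) * q) • (b * F a)

theorem isDerivation_psi (r : Fin n) : IsDerivation 0 (psi k deg r) := fun _ _ _ _ ha hb => by
  simpa using psi_mul k deg r ha hb

namespace IsDerivation

variable {m : ℤ} {F G : Poly k deg →ₗ[k] Poly k deg}

theorem map_one (hF : IsDerivation m F) : F 1 = 0 := by
  have h1 : (1 : Poly k deg) ∈ comp k deg 0 := SetLike.GradedOne.one_mem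
  simpa using hF h1 h1

theorem ext (hF : IsDerivation m F) (hG : IsDerivation m G)
    (h : ∀ i, F (x k deg i) = G (x k deg i)) : F = G := by
  refine linearMap_ext fun l => ?_
  induction l with
  | nil => exact hF.map_one.trans hG.map_one.symm
  | cons i l ih =>
    rw [List.map_cons, List.prod_cons, hF (x_mem k deg i) (word_mem k deg l),
      hG (x_mem k deg i) (word_mem k deg l), h, ih]

theorem sum {ι : Type*} {s : Finset ι} {F : ι → Poly k deg →ₗ[k] Poly k deg}
    (hF : ∀ r ∈ s, IsDerivation m (F r)) : IsDerivation m (∑ r ∈ s, F r) := fun _ _ _ _ ha hb => by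
  simp only [LinearMap.sum_apply, Finset.mul_sum, Finset.smul_sum, ← Finset.sum_add_distrib]
  exact Finset.sum_congr rfl fun r hr => hF r hr ha hb

theorem mulRight_comp (hF : IsDerivation m F) (c : Poly k deg) :
    IsDerivation m (LinearMap.mulRight k c ∘ₗ F) := fun _ _ _ _ ha hb => by
  simp [hF ha hb, add_mul, mul_assoc]

theorem sigma_comp (hF : IsDerivation m F) (i : Fin n) :
    IsDerivation (deg i + m) ((sigma i).toLinearMap ∘ₗ F) := fun p q a b ha hb => by
  simp only [LinearMap.comp_apply, AlgHom.toLinearMap_apply, hF ha hb, map_add, map_smul, map_mul,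
    sigma_of_mem i ha, sigma_of_mem i hb, smul_mul_assoc, smul_smul, neg_one_zpow_mul_neg_one_zpow]
  ring_nf

end IsDerivation

end Poly

namespace DGPoisson

open DGP.Poly

variable (P : DGPoisson (comp k deg))

theorem bracket_x_mem (i : Fin n) {p : ℤ} {a : Poly k deg} (ha : a ∈ comp k deg p) :
    P.bracket (x k deg i) a ∈ comp k deg (deg i + p) :=
  P.bracket_mem (x_mem k deg i) ha

theorem psi_bracket_x_x_mem (i j r : Fin n) :
    psi k deg r (P.bracket (x k deg i) (x k deg j)) ∈ comp k deg (deg i + deg j - deg r) :=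
  psi_mem r (P.bracket_x_mem i (x_mem k deg j))

theorem isDerivation_bracket_x (i : Fin n) : IsDerivation (deg i) (P.bracket (x k deg i)) :=
  fun _ _ _ _ ha hb => by
    rw [P.bracket_mul (x_mem k deg i) ha hb, P.graded_comm (P.bracket_x_mem i ha) hb, add_comm]

theorem isDerivation_bracket_left {p : ℤ} {a : Poly k deg} (ha : a ∈ comp k deg p) :
    IsDerivation 0 (P.bracket.flip a) := fun q r f g hf hg => by
  simp only [LinearMap.flip_apply]
  rw [P.antisymm (SetLike.mul_mem_graded hf hg) ha, P.bracket_mul ha hf hg, P.antisymm hg ha,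
    P.antisymm hf ha, P.graded_comm (P.bracket_mem ha hf) hg]
  simp only [mul_neg, smul_neg, mul_smul_comm, smul_smul, smul_add, neg_one_zpow_mul_neg_one_zpow,
    neg_add]
  rw [add_comm]
  congr 3
  · exact neg_one_zpow_eq_of_even_sub ⟨p * q, by ring⟩
  · exact neg_one_zpow_eq_of_even_sub ⟨p * r, by ring⟩

theorem bracket_eq_sum (f a : Poly k deg) :
    P.bracket f a = ∑ r, psi k deg r f * P.bracket (x k deg r) a := by
  induction a using induction_homogeneous with
  | homog p a ha =>
    have h := (P.isDerivation_bracket_left ha).ext (.sum fun r (_ : r ∈ Finset.univ) =>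
      (isDerivation_psi r).mulRight_comp (P.bracket (x k deg r) a)) fun i => by simp [psi_x]
    simpa using DFunLike.congr_fun h f
  | add a b ha hb => simp only [map_add, ha, hb, mul_add, Finset.sum_add_distrib]

theorem isDerivation_psi_bracket_x_sub (i t : Fin n) :
    IsDerivation (deg i) (psi k deg t ∘ₗ P.bracket (x k deg i) -
      P.bracket (x k deg i) ∘ₗ psi k deg t) := fun p q a b ha hb => by
  have hx := x_mem k deg i
  have ha' := P.bracket_x_mem i ha
  have hb' := P.bracket_x_mem i hb
  simp only [LinearMap.sub_apply, LinearMap.comp_apply, map_add, map_smul, P.bracket_mul hx ha hb,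
    psi_mul k deg t ha hb, psi_mul k deg t ha' hb, psi_mul k deg t ha hb',
    P.bracket_mul hx ha (psi_mem t hb), P.bracket_mul hx hb (psi_mem t ha), smul_add, smul_smul,
    neg_one_zpow_mul_neg_one_zpow, mul_sub, smul_sub]
  rw [neg_one_zpow_eq_of_even_sub (a := deg i * p + p * (deg i + q)) (b := p * q)
    ⟨deg i * p, by ring⟩, show (deg i + p) * q = p * q + deg i * q by ring]
  abel

theorem psi_bracket_x (i t : Fin n) (f : Poly k deg) :
    psi k deg t (P.bracket (x k deg i) f) = P.bracket (x k deg i) (psi k deg t f) +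
      ∑ r, sigma i (psi k deg r f) * psi k deg t (P.bracket (x k deg i) (x k deg r)) := by
  have hx1 := (P.isDerivation_bracket_x i).map_one
  have h := (P.isDerivation_psi_bracket_x_sub i t).ext (.sum fun r (_ : r ∈ Finset.univ) =>
    add_zero (deg i) ▸ ((isDerivation_psi r).sigma_comp i).mulRight_comp
      (psi k deg t (P.bracket (x k deg i) (x k deg r)))) fun j => by
    simp [psi_x, apply_ite, hx1]
  rw [← sub_eq_iff_eq_add']
  simpa using DFunLike.congr_fun h f

theorem bracket_x_mul (i : Fin n) (a b : Poly k deg) :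
    P.bracket (x k deg i) (a * b) =
      P.bracket (x k deg i) a * b + sigma i a * P.bracket (x k deg i) b := by
  induction a using induction_homogeneous with
  | homog p a ha =>
    induction b using induction_homogeneous with
    | homog q b hb =>
      rw [P.bracket_mul (x_mem k deg i) ha hb, sigma_of_mem i ha, smul_mul_assoc]
    | add b b' h h' => simp only [mul_add, map_add, h, h']; abel
  | add a a' h h' => simp only [add_mul, map_add, h, h']; abel

theorem bracket_x_sigma (i j : Fin n) (a : Poly k deg) :
    P.bracket (x k deg i) (sigma j a) =
      (-1 : k) ^ (deg i * deg j) • sigma j (P.bracket (x k deg i) a) := by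
  induction a using induction_homogeneous with
  | homog p a ha =>
    rw [sigma_of_mem _ ha, map_smul, sigma_of_mem _ (P.bracket_x_mem i ha), smul_smul,
      neg_one_zpow_mul_neg_one_zpow]
    congr 1
    exact neg_one_zpow_eq_of_even_sub ⟨-(deg i * deg j), by ring⟩
  | add a b ha hb => simp only [map_add, smul_add, ha, hb]

theorem sigma_sigma_mul_psi_bracket_x_x (i j r : Fin n) (a : Poly k deg) :
    sigma i (sigma j a) * psi k deg r (P.bracket (x k deg i) (x k deg j)) =
      psi k deg r (P.bracket (x k deg i) (x k deg j)) * sigma r a := by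
  induction a using induction_homogeneous with
  | homog p a ha =>
    simp only [sigma_of_mem _ ha, map_smul, smul_mul_assoc, mul_smul_comm, smul_smul,
      P.graded_comm ha (P.psi_bracket_x_x_mem i j r), neg_one_zpow_mul_neg_one_zpow]
    congr 1
    exact neg_one_zpow_eq_of_even_sub ⟨deg j * p + deg i * p - deg r * p, by ring⟩
  | add a b ha hb => simp only [map_add, add_mul, mul_add, ha, hb]

theorem sigma_psi_bracket_x_x (i j l r : Fin n) :
    (-1 : k) ^ (deg i * deg r) • sigma i (psi k deg r (P.bracket (x k deg j) (x k deg l))) =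
      ((-1 : k) ^ (deg i * deg j) * (-1 : k) ^ (deg i * deg l)) •
        psi k deg r (P.bracket (x k deg j) (x k deg l)) := by
  rw [sigma_of_mem _ (P.psi_bracket_x_x_mem j l r), smul_smul, neg_one_zpow_mul_neg_one_zpow,
    neg_one_zpow_mul_neg_one_zpow]
  ring_nf

theorem bracket_x_bracket_x (i j : Fin n) (a : Poly k deg) :
    P.bracket (x k deg i) (P.bracket (x k deg j) a) =
      (-1 : k) ^ (deg i * deg j) • P.bracket (x k deg j) (P.bracket (x k deg i) a) +
        ∑ r, psi k deg r (P.bracket (x k deg i) (x k deg j)) * P.bracket (x k deg r) a := by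
  rw [← P.bracket_eq_sum]
  induction a using induction_homogeneous with
  | homog p a ha => rw [P.jacobi (x_mem k deg i) (x_mem k deg j) ha, add_comm]
  | add a a' h h' => simp only [map_add, smul_add, h, h']; abel

theorem jacobi_x (i j l : Fin n) :
    P.bracket (x k deg i) (P.bracket (x k deg j) (x k deg l)) -
      (-1 : k) ^ (deg i * deg j) • P.bracket (x k deg j) (P.bracket (x k deg i) (x k deg l)) +
      ((-1 : k) ^ (deg i * deg l) * (-1 : k) ^ (deg j * deg l)) •
        P.bracket (x k deg l) (P.bracket (x k deg i) (x k deg j)) = 0 := by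
  have hx := x_mem k deg
  rw [P.jacobi (hx i) (hx j) (hx l), P.antisymm (P.bracket_mem (hx i) (hx j)) (hx l),
    neg_one_zpow_mul_neg_one_zpow, ← add_mul]
  abel

variable {P} {i : Fin n}

theorem bracket_x_self
    (h2 : (2 : k) = 0 → ∀ i, P.bracket (x k deg i) (x k deg i) = 0)
    (hs : (-1 : k) ^ (deg i * deg i) = 1) : P.bracket (x k deg i) (x k deg i) = 0 := by
  by_cases h : (2 : k) = 0
  · exact h2 h i
  · have ha := P.antisymm (x_mem k deg i) (x_mem k deg i)
    rw [hs, one_smul, eq_neg_iff_add_eq_zero, ← two_smul k] at ha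
    exact (smul_eq_zero.1 ha).resolve_left h

theorem bracket_x_bracket_x_self
    (h3 : (3 : k) = 0 → ∀ i, Odd (deg i) →
      P.bracket (x k deg i) (P.bracket (x k deg i) (x k deg i)) = 0)
    (hs : (-1 : k) ^ (deg i * deg i) ≠ 1) :
    P.bracket (x k deg i) (P.bracket (x k deg i) (x k deg i)) = 0 := by
  have hi := ((neg_one_zpow_mul_self_ne_one_iff _).1 hs).1
  by_cases h : (3 : k) = 0
  · exact h3 h i hi
  · have hj := P.jacobi_x i i i
    rw [(hi.mul hi).neg_one_zpow] at hj
    have hj' : (3 : k) • P.bracket (x k deg i) (P.bracket (x k deg i) (x k deg i)) = 0 := by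
      linear_combination (norm := module) hj
    exact (smul_eq_zero.1 hj').resolve_left h

end DGPoisson

section PolyBasis

variable (k deg)

/-- The presentation of `R` over `k`, with the `x_i` as generators. -/
noncomputable def polyPresentation : SkewPresentation k k (Fin n) where
  s i j := (-1) ^ (deg i * deg j)
  σ _ := .id k k
  δ _ := 0
  c _ _ _ := 0
  s_mul_s_swap i j := by
    rw [mul_comm (deg j), ← mul_zpow, neg_one_mul, neg_neg, one_zpow]
  δ_mul := by simp

theorem isConsistent_polyPresentation : (polyPresentation k deg).IsConsistent where
  σ_comm := by simp [polyPresentation]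
  δ_σ := by simp [polyPresentation]
  δ_δ := by simp [polyPresentation]
  σ_σ_mul_c := by simp [polyPresentation]
  σ_c := by simp [polyPresentation]
  c_antisymm _ _ := by ext; simp [polyPresentation]
  c_self _ _ := rfl
  jacobi _ _ _ := by ext; simp [polyPresentation, SkewPresentation.ad]
  jacobi_self _ _ := by ext; simp [polyPresentation, SkewPresentation.ad]

/-- The action of `R` on the vector space of normal words. -/
noncomputable def polyAction : Poly k deg →ₐ[k] Module.End k (polyPresentation k deg).Mod :=
  Poly.lift k deg (polyPresentation k deg).Y fun i j => LinearMap.ext fun m => by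
    have h := (isConsistent_polyPresentation k deg).isRep_Y.commAt i j m
    have hc : (polyPresentation k deg).c i j = 0 := rfl
    rw [SkewPresentation.CommAt, hc, map_zero, LinearMap.zero_apply, add_zero] at h
    exact h

/-- The basis of `R` consisting of the ordered monomials. -/
noncomputable def polyBasis : Module.Basis (polyPresentation k deg).Word k (Poly k deg) :=
  SkewPresentation.pbwBasis (y := Poly.x k deg)
    (SkewPresentation.isRep_lmul (fun _ _ => by simp [polyPresentation]) fun i j => by
      simpa [polyPresentation] using Poly.x_comm k deg i j)
    (top_le_iff.1 (Poly.adjoin_range_x.ge.trans (Algebra.adjoin_mono Set.subset_union_right)))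
    (polyAction k deg) (fun _ _ => by simp) (Poly.lift_x k deg _ _)

theorem polyBasis_apply (K : (polyPresentation k deg).Word) :
    polyBasis k deg K = (K.toList.map (Poly.x k deg)).prod :=
  SkewPresentation.pbwBasis_apply ..

end PolyBasis

section FreePoly

variable {B : Type*} [Ring B] [Algebra k B] (φ : Poly k deg →ₐ[k] B) (y : Fin n → B)

theorem FreePoly.incl_x (i : Fin n) : FreePoly.incl k deg (Poly.x k deg i) =
    RingQuot.mkAlgHom k (FreeRel k deg) (FreeAlgebra.ι k (Sum.inl i)) :=
  Poly.lift_x k deg _ _ i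

/-- The universal property of `F(R)`. -/
noncomputable def FreePoly.lift : FreePoly k deg →ₐ[k] B :=
  RingQuot.liftAlgHom k ⟨FreeAlgebra.lift k (Sum.elim (fun i => φ (Poly.x k deg i)) y), by
    rintro _ _ ⟨i, j⟩
    simp only [map_mul, map_smul, FreeAlgebra.lift_ι_apply, Sum.elim_inl]
    rw [← map_mul, Poly.x_comm, map_smul, map_mul]⟩

@[simp] theorem FreePoly.lift_y (i : Fin n) : FreePoly.lift φ y (FreePoly.y k deg i) = y i :=
  (RingQuot.liftAlgHom_mkAlgHom_apply k _ _ _).trans (FreeAlgebra.lift_ι_apply _ _)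

@[simp] theorem FreePoly.lift_incl (a : Poly k deg) :
    FreePoly.lift φ y (FreePoly.incl k deg a) = φ a := by
  have h : (FreePoly.lift φ y).comp (FreePoly.incl k deg) = φ := Poly.hom_ext k deg fun i => by
    rw [AlgHom.comp_apply, FreePoly.incl_x]
    exact (RingQuot.liftAlgHom_mkAlgHom_apply k _ _ _).trans (FreeAlgebra.lift_ι_apply _ _)
  exact DFunLike.congr_fun h a

end FreePoly

variable (P : DGPoisson (Poly.comp k deg))

/-- The presentation of `R^e` over `R`, with the `y_i` as generators. -/
noncomputable def envPresentation : SkewPresentation k (Poly k deg) (Fin n) where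
  s i j := (-1) ^ (deg i * deg j)
  σ := Poly.sigma
  δ i := P.bracket (Poly.x k deg i)
  c i j r := Poly.psi k deg r (P.bracket (Poly.x k deg i) (Poly.x k deg j))
  s_mul_s_swap := (polyPresentation k deg).s_mul_s_swap
  δ_mul := P.bracket_x_mul

theorem envPresentation_ad_c (i j l : Fin n) :
    (envPresentation P).ad i ((envPresentation P).c j l) = fun t => Poly.psi k deg t
      (P.bracket (Poly.x k deg i) (P.bracket (Poly.x k deg j) (Poly.x k deg l))) :=
  funext fun t => (P.psi_bracket_x i t _).symm

variable {P} in
theorem isConsistent_envPresentation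
    (h2 : (2 : k) = 0 → ∀ i, P.bracket (Poly.x k deg i) (Poly.x k deg i) = 0)
    (h3 : (3 : k) = 0 → ∀ i, Odd (deg i) →
      P.bracket (Poly.x k deg i) (P.bracket (Poly.x k deg i) (Poly.x k deg i)) = 0) :
    (envPresentation P).IsConsistent where
  σ_comm := Poly.sigma_comm
  δ_σ := P.bracket_x_sigma
  δ_δ := P.bracket_x_bracket_x
  σ_σ_mul_c := P.sigma_sigma_mul_psi_bracket_x_x
  σ_c := P.sigma_psi_bracket_x_x
  c_antisymm i j := funext fun r => by
    simp [envPresentation, P.antisymm (Poly.x_mem k deg i) (Poly.x_mem k deg j)]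
  c_self i hs := funext fun r => by
    simp [envPresentation, DGPoisson.bracket_x_self h2 hs]
  jacobi i j l := funext fun t => by
    have h := congrArg (Poly.psi k deg t) (P.jacobi_x i j l)
    simp only [map_add, map_sub, map_smul, map_zero] at h
    simp only [envPresentation_ad_c]
    exact h
  jacobi_self i hs := by
    rw [envPresentation_ad_c, DGPoisson.bracket_x_bracket_x_self h3 hs]
    simp only [map_zero]
    rfl

namespace Env

noncomputable instance : Module (Poly k deg) (Env P) :=
  Module.compHom _ ((proj P).comp (FreePoly.incl k deg)).toRingHom

variable {P} in
theorem smul_def (a : Poly k deg) (b : Env P) : a • b = proj P (FreePoly.incl k deg a) * b := rfl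

instance : IsScalarTower (Poly k deg) (Env P) (Env P) :=
  ⟨fun _ _ _ => mul_assoc _ _ _⟩

instance : IsScalarTower k (Poly k deg) (Env P) :=
  ⟨fun t a b => by simp only [smul_def, map_smul, smul_mul_assoc]⟩

variable {P}

theorem yy (i j : Fin n) : y P i * y P j = (-1 : k) ^ (deg i * deg j) • (y P j * y P i) +
    ∑ r, Poly.psi k deg r (P.bracket (Poly.x k deg i) (Poly.x k deg j)) • y P r := by
  have h := RingQuot.mkAlgHom_rel k (EnvRel.yy (P := P) i j)
  simp only [map_add, map_mul, map_smul, FreePoly.psi, map_sum] at h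
  exact h

theorem yx (i j : Fin n) : y P i * Poly.x k deg j • 1 =
    Poly.sigma i (Poly.x k deg j) • y P i + P.bracket (Poly.x k deg i) (Poly.x k deg j) • 1 := by
  have h := RingQuot.mkAlgHom_rel k (EnvRel.yx (P := P) i j)
  simp only [map_add, map_mul, map_smul] at h
  rw [Poly.sigma_of_mem i (Poly.x_mem k deg j), smul_assoc]
  simp only [smul_def, mul_one]
  exact h

theorem y_mul_smul_one (i : Fin n) (a : Poly k deg) :
    y P i * a • 1 = Poly.sigma i a • y P i + P.bracket (Poly.x k deg i) a • 1 := by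
  induction Poly.adjoin_range_x.ge (Algebra.mem_top (x := a)) using Algebra.adjoin_induction with
  | mem a ha =>
    obtain ⟨j, rfl⟩ := ha
    exact yx i j
  | algebraMap t =>
    simp only [Algebra.algebraMap_eq_smul_one, map_smul, map_one, smul_assoc, one_smul,
      mul_smul_comm, mul_one, (P.isDerivation_bracket_x i).map_one, zero_smul, smul_zero, add_zero]
  | add a b _ _ h h' => simp only [map_add, mul_add, add_smul, h, h']; abel
  | mul a b _ _ h h' =>
    calc y P i * (a * b) • 1 = (y P i * a • 1) * b • 1 := by
          rw [mul_assoc, smul_one_mul, mul_smul]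
      _ = Poly.sigma i a • (y P i * b • 1) + P.bracket (Poly.x k deg i) a • b • 1 := by
          rw [h, add_mul, smul_mul_assoc, smul_one_mul]
      _ = _ := by
          rw [h', smul_add, P.bracket_x_mul, add_smul, map_mul]
          simp only [mul_smul]
          abel

theorem isRep_lmul : (envPresentation P).IsRep fun i => Algebra.lmul k (Env P) (y P i) :=
  SkewPresentation.isRep_lmul (D := envPresentation P) (y := y P) y_mul_smul_one yy

theorem adjoin_eq_top : Algebra.adjoin k
    (Set.range (fun a : Poly k deg => (a • 1 : Env P)) ∪ Set.range (y P)) = ⊤ := by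
  let π : FreeAlgebra k (Fin n ⊕ Fin n) →ₐ[k] Env P :=
    (proj P).comp (RingQuot.mkAlgHom k (FreeRel k deg))
  have hπ : Function.Surjective π :=
    (RingQuot.mkAlgHom_surjective k (EnvRel P)).comp
      (RingQuot.mkAlgHom_surjective k (FreeRel k deg))
  rw [← top_le_iff, ← (AlgHom.range_eq_top π).2 hπ, ← Algebra.map_top,
    ← FreeAlgebra.adjoin_range_ι, AlgHom.map_adjoin]
  refine Algebra.adjoin_mono ?_
  rintro _ ⟨_, ⟨i | i, rfl⟩, rfl⟩
  · refine Or.inl ⟨Poly.x k deg i, ?_⟩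
    dsimp only
    rw [smul_def, mul_one, FreePoly.incl_x]
    rfl
  · exact Or.inr ⟨i, rfl⟩

end Env

section EnvBasis

variable {P} (hP : (envPresentation P).IsConsistent)

/-- The action of `R^e` on the free `R`-module on the normal words. -/
noncomputable def envAction : Env P →ₐ[k] Module.End k (envPresentation P).Mod :=
  RingQuot.liftAlgHom k ⟨FreePoly.lift (Algebra.lsmul k k _) (envPresentation P).Y, by
    rintro _ _ (⟨i, j⟩ | ⟨i, j⟩) <;> refine LinearMap.ext fun m => ?_
    · simp only [FreePoly.psi, map_add, map_mul, map_smul, map_sum, FreePoly.lift_y,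
        FreePoly.lift_incl, LinearMap.add_apply, LinearMap.sum_apply, LinearMap.smul_apply,
        Module.End.mul_apply, Algebra.lsmul_coe]
      rw [← SkewPresentation.linearCombination_apply_apply]
      exact hP.isRep_Y.commAt i j m
    · have h := hP.isRep_Y.isSkew i (Poly.x k deg j) m
      simp only [map_add, map_mul, map_smul, FreePoly.lift_y, FreePoly.lift_incl,
        LinearMap.add_apply, LinearMap.smul_apply, Module.End.mul_apply, Algebra.lsmul_coe]
      rw [← smul_assoc, ← Poly.sigma_of_mem i (Poly.x_mem k deg j)]
      exact h⟩

theorem envAction_proj (f : FreePoly k deg) : envAction hP (Env.proj P f) =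
    FreePoly.lift (Algebra.lsmul k k _) (envPresentation P).Y f :=
  RingQuot.liftAlgHom_mkAlgHom_apply k _ _ _

/-- The `R`-basis of `R^e` consisting of the ordered monomials in the `y_i`. -/
noncomputable def envBasis : Module.Basis (envPresentation P).Word (Poly k deg) (Env P) :=
  SkewPresentation.pbwBasis Env.isRep_lmul Env.adjoin_eq_top (envAction hP)
    (fun a m => by rw [Env.smul_def, mul_one, envAction_proj, FreePoly.lift_incl]; rfl)
    (fun i => by rw [Env.y, envAction_proj, FreePoly.lift_y])

theorem envBasis_apply (K : (envPresentation P).Word) :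
    envBasis hP K = (K.toList.map (Env.y P)).prod :=
  SkewPresentation.pbwBasis_apply ..

end EnvBasis

/-- Words in the `x_i` and the `y_i` correspond to the exponent vectors of the PBW monomials. -/
def equivPBWExponent :
    (polyPresentation k deg).Word × (envPresentation P).Word ≃ PBWExponent k deg :=
  (NormalWord.equivExponent.symm.prodCongr NormalWord.equivExponent.symm).trans <|
    Equiv.subtypeProdEquivProd.symm.trans <|
      Equiv.subtypeEquivRight fun _ => by
        simp only [polyPresentation, envPresentation, ← ne_eq, neg_one_zpow_mul_self_ne_one_iff,
          and_imp, forall_and]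

variable {P} (hP : (envPresentation P).IsConsistent)

/-- The PBW basis of `R^e`. -/
noncomputable def monomialBasis : Module.Basis (PBWExponent k deg) k (Env P) :=
  ((polyBasis k deg).smulTower (envBasis hP)).reindex (equivPBWExponent P)

theorem monomialBasis_apply (e : PBWExponent k deg) :
    monomialBasis hP e = Env.monomial P e.1.1 e.1.2 := by
  rw [monomialBasis, Module.Basis.reindex_apply, Module.Basis.smulTower_apply, polyBasis_apply,
    envBasis_apply, Env.smul_def, map_list_prod, map_list_prod, List.map_map, List.map_map]
  exact congrArg₂ (· * ·) (prod_map_sortedWord _ _) (prod_map_sortedWord _ _)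

end DGP

theorem mainTheorem2 {k : Type*} [Field k] {n : ℕ} (deg : Fin n → ℤ)
    (P : DGP.DGPoisson (DGP.Poly.comp k deg))
    (h2 : (2 : k) = 0 → ∀ i, P.bracket (DGP.Poly.x k deg i) (DGP.Poly.x k deg i) = 0)
    (h3 : (3 : k) = 0 → ∀ i, Odd (deg i) →
      P.bracket (DGP.Poly.x k deg i)
        (P.bracket (DGP.Poly.x k deg i) (DGP.Poly.x k deg i)) = 0) :
    ∃ b : Module.Basis (DGP.PBWExponent k deg) k (DGP.Env P),
      ∀ e : DGP.PBWExponent k deg, b e = DGP.Env.monomial P e.1.1 e.1.2 :=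
  have hP := DGP.isConsistent_envPresentation h2 h3
  ⟨DGP.monomialBasis hP, DGP.monomialBasis_apply hP⟩
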